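/- **Setting.** Let $\mathbb F\in\{\mathbb R,\mathbb C\}$, let $(\mathbb X,\|\cdot\|)$ be a quasi-Banach space over $\mathbb F$ (complete for a quasi-norm: $\|x\|=0$ iff $x=0$, $\|tx\|=|t|\|x\|$, $\|x+y\|\le\kappa(\|x\|+\|y\|)$), and let $\mathcal B=(e_n)_{n\ge1}$ be a semi-normalized Markushevich basis (M-basis) of $\mathbb X$ with biorthogonal functionals $(e_n^*)_{n\ge 1}\subset \mathbb X^*$: $e_i^*(e_j)=\delta_{ij}$; for some $c_1,c_2>0$, $c_1\le\|e_n\|,\|e_n^*\|_*\le c_2$ for all $n$; $\operatorname{span}\{e_n\}$ is dense; and $x=0$ if $e_n^*(x)=0$ for all $n$. Here $\mathbb N=\{1,2,\dots\}$. *Errors.* $S_m(x)=\sum_{n=1}^m e_n^*(x)e_n$ and $\beta_m(x)=\|x-S_m(x)\|$. A greedy ordering of $x$ is an injective map $\pi:\mathbb N\to\mathbb N$ with $\{n:e_n^*(x)\ne0\}\subset\pi(\mathbb N)$ and $|e_{\pi(i)}^*(x)|\ge|e_{\pi(j)}^*(x)|$ for $i\le j$; $G_m^\pi(x)=\sum_{n=1}^m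 e^*_{\pi(n)}(x)e_{\pi(n)}$, and $\gamma_m(x)=\sup_\pi\|x-G_m^\pi(x)\|$ over all greedy orderings $\pi$ of $x$. *Types of bases.* $\mathcal B$ is quasi-greedy if for some constant $C>0$, $\gamma_m(x)\le C\|x\|$ for all $x\in\mathbb X$, $m\in\mathbb N$; partially greedy if for some $C>0$, $\gamma_m(x)\le C\beta_m(x)$ for all $x,m$; Schauder if for some $C>0$, $\|S_m(x)\|\le C\|x\|$ for all $x,m$. *Weights.* A doubling weight is a sequence $\omega=(\omega(n))_{n\ge1}$ with $0<\omega(1)\le\omega(2)\le\cdots$, $\omega(n)\to\infty$, and $\omega(2n)\le\theta\,\omega(n)$ for all $n$, for some $\theta\ge1$. Its lower dilation index is $i_\omega=\sup_{M>1}\frac{\ln\varphi_\omega(M)}{\ln M}$, where $\varphi_\omega(M)=\inf_{k\ge1}\frac{\omega(Mk)}{\omega(k)}$ for integers $M\ge 1$. *Classes.* For $0<q<\infty$, $\mathcal G_q^\omega$ is the set of $x\in\mathbb X$ with $\|x\|_{\mathcal G_q^\omega}:=\|x\|+\big(\sum_{n\ge1}(\omega(n)\gamma_n(x))^q\frac1n\big)^{1/q}<\infty$;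 for $q=\infty$ the second term is $\sup_{n\ge1}\omega(n)\gamma_n(x)$. The class $\mathcal{PG}_q^\omega$ and $\|\cdot\|_{\mathcal{PG}_q^\omega}$ are defined in the same way with $\beta_n$ in place of $\gamma_n$. We write $Y\hookrightarrow Z$ if $Y\subset Z$ and there is $C>0$ with $\|x\|_Z\le C\|x\|_Y$ for all $x\in Y$. *Democracy functions.* For finite $A\subset\mathbb N$ and scalars $\varepsilon=(\varepsilon_n)_{n\in A}$ with $|\varepsilon_n|=1$ for all $n\in A$ (written $|\varepsilon|=1$), put $1_{\varepsilon A}=\sum_{n\in A}\varepsilon_ne_n$. Let $$h_l(m)=\inf_{|A|\ge m,\,|\varepsilon|=1}\|1_{\varepsilon A}\|,\qquad h_{R,l}(m,u)=\sup_{|A|=m,\,\max A\le u,\,|\varepsilon|=1}\|1_{\varepsilon A}\|\ (m\le u),\qquad h_{R,r}(m,u)=\inf_{|A|=m,\,\min A>u,\,|\varepsilon|=1}\|1_{\varepsilon A}\| .$$ A function $\psi:\mathbb N\to\mathbb N$ is characteristic if $\psi(m)\ge m$ for all $m$ and, for some $C>0$, $\sup_{u\ge m}h_{R,l}(m,u)\le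 C\,h_{R,l}(m,\psi(m))$ for all $m\in\mathbb N$. *Property (I):* (i) $\displaystyle\sup_{\ell\ge0,\,u\ge1}\frac{h_{R,r}(2^{\ell+1}u,u)}{h_{R,r}(2^\ell u,u)}<\infty$, and (ii) there are a characteristic function $\psi$ and a constant $C>0$ with $h_{R,r}(u,u)\le C\,h_{R,r}(m,u)$ for all $m,u\in\mathbb N$ with $u\le\psi(m)$. *Property (W$^*$):* there are $C_1,C_2>0$ such that for every $m\in\mathbb N$ there exist $A\subset\{n\in\mathbb N:n\le C_1m\}$ with $|A|=m$ and $|\varepsilon|=1$ such that $\|1_{\varepsilon A}\|\le C_2h_l(m)$. **Theorem.** Let $\omega$ be a doubling weight with $i_\omega>0$, and let $\mathcal B$ be a quasi-greedy M-basis of a quasi-Banach space $\mathbb X$. 1. If $\mathcal B$ is partially greedy, then $\mathcal{PG}_q^\omega\hookrightarrow\mathcal G_q^\omega$ for all $q\in(0,\infty]$. 2. If $\mathcal B$ is Schauder with Property (I) and Property (W$^*$), and $\mathcal{PG}_q^\omega\hookrightarrow\mathcal G_q^\omega$ for some $q\in(0,\infty]$, then $\mathcal B$ is partially greedy. -/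

import Mathlib

open scoped ENNReal BigOperators

namespace GreedyApprox

/-- A quasi-norm on a vector space over `𝕜` (the real or complex field). -/
structure QuasiNorm (𝕜 X : Type*) [RCLike 𝕜] [AddCommGroup X] [Module 𝕜 X] where
  toFun : X → ℝ
  nonneg : ∀ x, 0 ≤ toFun x
  eq_zero_iff : ∀ x, toFun x = 0 ↔ x = 0
  smul_eq : ∀ (t : 𝕜) (x : X), toFun (t • x) = ‖t‖ * toFun x
  add_le : ∃ κ : ℝ, 1 ≤ κ ∧ ∀ x y, toFun (x + y) ≤ κ * (toFun x + toFun y)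

instance {𝕜 X : Type*} [RCLike 𝕜] [AddCommGroup X] [Module 𝕜 X] :
    CoeFun (QuasiNorm 𝕜 X) (fun _ => X → ℝ) := ⟨QuasiNorm.toFun⟩

namespace QuasiNorm

/-- Completeness: every Cauchy sequence converges. A space with a complete quasi-norm is a
quasi-Banach space. -/
def IsComplete {𝕜 X : Type*} [RCLike 𝕜] [AddCommGroup X] [Module 𝕜 X]
    (N : QuasiNorm 𝕜 X) : Prop :=
  ∀ u : ℕ → X, (∀ ε : ℝ, 0 < ε → ∃ n₀ : ℕ, ∀ m n, n₀ ≤ m → n₀ ≤ n → N (u m - u n) < ε) →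
    ∃ x : X, ∀ ε : ℝ, 0 < ε → ∃ n₀ : ℕ, ∀ n, n₀ ≤ n → N (u n - x) < ε

/-- The norm of a linear functional, `sup {|f x| : ‖x‖ ≤ 1}` (infinite if `f` is unbounded). -/
noncomputable def dualNorm {𝕜 X : Type*} [RCLike 𝕜] [AddCommGroup X] [Module 𝕜 X]
    (N : QuasiNorm 𝕜 X) (f : X →ₗ[𝕜] 𝕜) : ℝ≥0∞ :=
  ⨆ (x : X) (_ : N x ≤ 1), ENNReal.ofReal ‖f x‖

end QuasiNorm

/-- A semi-normalized Markushevich basis together with its (unique) biorthogonal functionals.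
The vector written `e_n` (`n = 1, 2, …`) on paper is `e (n - 1)` here, so the paper's first `m`
indices `1, …, m` are the elements of `Finset.range m`. -/
structure MBasis {𝕜 X : Type*} [RCLike 𝕜] [AddCommGroup X] [Module 𝕜 X]
    (N : QuasiNorm 𝕜 X) where
  e : ℕ → X
  coord : ℕ → X →ₗ[𝕜] 𝕜
  biorthogonal : ∀ i j, coord i (e j) = if i = j then 1 else 0
  seminormalized : ∃ c₁ c₂ : ℝ, 0 < c₁ ∧ ∀ n,
    c₁ ≤ N (e n) ∧ N (e n) ≤ c₂ ∧
    ENNReal.ofReal c₁ ≤ N.dualNorm (coord n) ∧ N.dualNorm (coord n) ≤ ENNReal.ofReal c₂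
  dense_span : ∀ x : X, ∀ ε : ℝ, 0 < ε →
    ∃ y ∈ Submodule.span 𝕜 (Set.range e), N (x - y) < ε
  total : ∀ x : X, (∀ n, coord n x = 0) → x = 0

/-- `ρ` and `σ` are extended-valued functionals defining the classes `{ρ < ∞}` and `{σ < ∞}`.
The first class embeds continuously in the second one. -/
def ContEmbeds {X : Type*} (ρ σ : X → ℝ≥0∞) : Prop :=
  {x | ρ x < ⊤} ⊆ {x | σ x < ⊤} ∧
    ∃ C : ℝ, 0 < C ∧ ∀ x, ρ x < ⊤ → σ x ≤ ENNReal.ofReal C * ρ x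

namespace MBasis

variable {𝕜 X : Type*} [RCLike 𝕜] [AddCommGroup X] [Module 𝕜 X] {N : QuasiNorm 𝕜 X}

/-- The partial sum `S_m(x)`. -/
noncomputable def partialSum (B : MBasis N) (m : ℕ) (x : X) : X :=
  ∑ n ∈ Finset.range m, B.coord n x • B.e n

/-- The error `β_m(x) = ‖x - S_m(x)‖`. -/
noncomputable def beta (B : MBasis N) (m : ℕ) (x : X) : ℝ≥0∞ :=
  ENNReal.ofReal (N (x - B.partialSum m x))

/-- `π` is a greedy ordering of `x`: it enumerates without repetition a set of indices that
contains the support of `x`, in nonincreasing order of the moduli of the coefficients. -/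
def IsGreedyOrdering (B : MBasis N) (x : X) (π : ℕ → ℕ) : Prop :=
  Function.Injective π ∧ {n | B.coord n x ≠ 0} ⊆ Set.range π ∧
    ∀ i j, i ≤ j → ‖B.coord (π j) x‖ ≤ ‖B.coord (π i) x‖

/-- The greedy sum `G_m^π(x)`. -/
noncomputable def greedySum (B : MBasis N) (π : ℕ → ℕ) (m : ℕ) (x : X) : X :=
  ∑ n ∈ Finset.range m, B.coord (π n) x • B.e (π n)

/-- The greedy error `γ_m(x)`, a supremum over all greedy orderings of `x`. -/
noncomputable def gamma (B : MBasis N) (m : ℕ) (x : X) : ℝ≥0∞ :=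
  ⨆ (π : ℕ → ℕ) (_ : B.IsGreedyOrdering x π), ENNReal.ofReal (N (x - B.greedySum π m x))

def IsSchauder (B : MBasis N) : Prop :=
  ∃ C : ℝ, 0 < C ∧ ∀ m : ℕ, 1 ≤ m → ∀ x : X, N (B.partialSum m x) ≤ C * N x

def IsQuasiGreedy (B : MBasis N) : Prop :=
  ∃ C : ℝ, 0 < C ∧ ∀ m : ℕ, 1 ≤ m → ∀ x : X, B.gamma m x ≤ ENNReal.ofReal (C * N x)

def IsPartiallyGreedy (B : MBasis N) : Prop :=
  ∃ C : ℝ, 0 < C ∧ ∀ m : ℕ, 1 ≤ m → ∀ x : X, B.gamma m x ≤ ENNReal.ofReal C * B.beta m x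

/-- The indicator sum `1_{εA}`. -/
noncomputable def indicatorSum (B : MBasis N) (ε : ℕ → 𝕜) (A : Finset ℕ) : X :=
  ∑ n ∈ A, ε n • B.e n

/-- The lower democracy function `h_l(m)`. -/
noncomputable def hl (B : MBasis N) (m : ℕ) : ℝ≥0∞ :=
  ⨅ (A : Finset ℕ) (ε : ℕ → 𝕜) (_ : m ≤ A.card ∧ ∀ n ∈ A, ‖ε n‖ = 1),
    ENNReal.ofReal (N (B.indicatorSum ε A))

/-- The left restricted democracy function `h_{R,l}(m,u)`, meant for `m ≤ u`: the supremum is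
over the sets of `m` indices among the first `u` ones. -/
noncomputable def hRl (B : MBasis N) (m u : ℕ) : ℝ≥0∞ :=
  ⨆ (A : Finset ℕ) (ε : ℕ → 𝕜)
    (_ : A.card = m ∧ (∀ n ∈ A, n < u) ∧ ∀ n ∈ A, ‖ε n‖ = 1),
    ENNReal.ofReal (N (B.indicatorSum ε A))

/-- The right restricted democracy function `h_{R,r}(m,u)`: the infimum is over the sets of `m`
indices that avoid the first `u` ones. -/
noncomputable def hRr (B : MBasis N) (m u : ℕ) : ℝ≥0∞ :=
  ⨅ (A : Finset ℕ) (ε : ℕ → 𝕜)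
    (_ : A.card = m ∧ (∀ n ∈ A, u ≤ n) ∧ ∀ n ∈ A, ‖ε n‖ = 1),
    ENNReal.ofReal (N (B.indicatorSum ε A))

/-- `ψ` is a characteristic function of `h_{R,l}`. -/
def IsCharacteristic (B : MBasis N) (ψ : ℕ → ℕ) : Prop :=
  (∀ m, 1 ≤ m → m ≤ ψ m) ∧
    ∃ C : ℝ, 0 < C ∧ ∀ m, 1 ≤ m →
      (⨆ (u : ℕ) (_ : m ≤ u), B.hRl m u) ≤ ENNReal.ofReal C * B.hRl m (ψ m)

/-- Property (I). -/
def PropertyI (B : MBasis N) : Prop :=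
  (⨆ (l : ℕ) (u : ℕ) (_ : 1 ≤ u), B.hRr (2 ^ (l + 1) * u) u / B.hRr (2 ^ l * u) u) < ⊤ ∧
    ∃ ψ : ℕ → ℕ, B.IsCharacteristic ψ ∧
      ∃ C : ℝ, 0 < C ∧ ∀ m u : ℕ, 1 ≤ m → 1 ≤ u → u ≤ ψ m →
        B.hRr u u ≤ ENNReal.ofReal C * B.hRr m u

/-- Property (W*). The index called `n` here is the paper's `n + 1`. -/
def PropertyWStar (B : MBasis N) : Prop :=
  ∃ C₁ C₂ : ℝ, 0 < C₁ ∧ 0 < C₂ ∧ ∀ m : ℕ, 1 ≤ m →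
    ∃ (A : Finset ℕ) (ε : ℕ → 𝕜), A.card = m ∧ (∀ n ∈ A, (n : ℝ) + 1 ≤ C₁ * m) ∧
      (∀ n ∈ A, ‖ε n‖ = 1) ∧
      ENNReal.ofReal (N (B.indicatorSum ε A)) ≤ ENNReal.ofReal C₂ * B.hl m

open Classical in
/-- `‖x‖ + (∑_{n ≥ 1} (ω(n) E_n(x))^q / n)^{1/q}` for `q < ∞` and
`‖x‖ + sup_{n ≥ 1} ω(n) E_n(x)` for `q = ∞`, where `E_n(x)` is an error functional. -/
noncomputable def classNorm (N : QuasiNorm 𝕜 X) (E : ℕ → X → ℝ≥0∞) (ω : ℕ → ℝ) (q : ℝ≥0∞)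
    (x : X) : ℝ≥0∞ :=
  ENNReal.ofReal (N x) +
    if q = ⊤ then ⨆ n : ℕ, ENNReal.ofReal (ω (n + 1)) * E (n + 1) x
    else (∑' n : ℕ, (ENNReal.ofReal (ω (n + 1)) * E (n + 1) x) ^ q.toReal
      / ((n + 1 : ℕ) : ℝ≥0∞)) ^ (1 / q.toReal)

/-- The functional defining the greedy class `𝒢_q^ω`. -/
noncomputable def greedyNorm (B : MBasis N) (ω : ℕ → ℝ) (q : ℝ≥0∞) : X → ℝ≥0∞ :=
  classNorm N B.gamma ω q

/-- The functional defining the partially greedy class `𝒫𝒢_q^ω`. -/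
noncomputable def partiallyGreedyNorm (B : MBasis N) (ω : ℕ → ℝ) (q : ℝ≥0∞) : X → ℝ≥0∞ :=
  classNorm N B.beta ω q

end MBasis

/-- A doubling weight `(ω(n))_{n ≥ 1}`: positive, nondecreasing, tending to infinity, and with
`ω(2n) ≤ θ ω(n)`. The value `ω 0` is never used. -/
def IsDoublingWeight (ω : ℕ → ℝ) : Prop :=
  0 < ω 1 ∧ (∀ m n, 1 ≤ m → m ≤ n → ω m ≤ ω n) ∧ Filter.Tendsto ω Filter.atTop Filter.atTop ∧
    ∃ θ : ℝ, 1 ≤ θ ∧ ∀ n, 1 ≤ n → ω (2 * n) ≤ θ * ω n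

/-- The lower dilation sequence `φ_ω(M) = inf_{k ≥ 1} ω(Mk) / ω(k)`. -/
noncomputable def lowerDilation (ω : ℕ → ℝ) (M : ℕ) : ℝ :=
  ⨅ k : {k : ℕ // 1 ≤ k}, ω (M * k) / ω k

/-- The lower dilation index `i_ω = sup_{M > 1} ln φ_ω(M) / ln M`. -/
noncomputable def lowerDilationIndex (ω : ℕ → ℝ) : EReal :=
  ⨆ (M : ℕ) (_ : 1 < M), ((Real.log (lowerDilation ω M) / Real.log M : ℝ) : EReal)

end GreedyApprox

/-! Part 1 is pointwise: if `γ_m ≤ C β_m` for every `m`, the inequality passes through the weighted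
norm. All the work is in part 2, which reduces to super-conservativity: `‖1_{εA}‖ ≲ ‖1_{δD}‖`
whenever `|A| = |D|` and `A` lies to the left of `D`.

Super-conservativity suffices. With `y = x - S_m(x)`, a greedy set `G` of size `m`, and `D` the part
of `G` beyond the first `m` indices, `x - G_m(x)` is `y - P_D y` plus the projection of `x` onto
`[1,m] \ G`. The set `D` is greedy for `y`, so the first summand is controlled by quasi-greediness.
The second lives on a set of size `|D|`, left of `D`, with smaller coefficients. To compare it with
`P_D y`, coefficients are replaced by signs: in a quasi-greedy basis, coefficients in `[0,1]`
enlarge `1_{εA}` at most by a constant factor (`exists_convex_le`), and coefficients at least `1`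
dominate it (`exists_indicator_le_of_one_le`).

To obtain super-conservativity, the embedding is tested on `1_{ε[1,u]} + 1_{εD}` with `D` to the
right of `u` (`exists_embedding_test`). Greedy sums may exhaust `D` first, so `γ_n` stays above a
multiple of `P = ‖1_{ε[1,u]}‖` for `n` up to `|D|`. In contrast, beyond `u`, `β_n` sees only `R =
‖1_{εD}‖`. Hence `ω(v) P ≤ K (ω(u) P + ω(U) R)` with `v` about `|D|/2` and `U` a bound for `D`. A
positive dilation index lets `v`, a fixed multiple of `u`, satisfy `ω(v) ≥ 2K ω(u)`, so the `P` term
is absorbed; doubling gives `P ≲ R`. Property (W*) supplies a `D` that is nearly minimal in norm and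
lies within a multiple of `u`, so that `P ≲ h_l(2^{l+2}u) ≤ h_{R,r}(2^{l+2}u, u) ≲ h_{R,r}(u,u)` by
Property (I)(i). Property (I)(ii) and the characteristic function pass from initial segments to
arbitrary sets `A` to the left of `D`. -/

namespace GreedyApprox

/-! ### Modulus of concavity -/

namespace QuasiNorm

variable {𝕜 X : Type*} [RCLike 𝕜] [AddCommGroup X] [Module 𝕜 X]

/-- A modulus of concavity of the quasi-norm. -/
noncomputable def modulus (N : QuasiNorm 𝕜 X) : ℝ := Classical.choose N.add_le

lemma one_le_modulus (N : QuasiNorm 𝕜 X) : 1 ≤ N.modulus :=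
  (Classical.choose_spec N.add_le).1

lemma modulus_pos (N : QuasiNorm 𝕜 X) : 0 < N.modulus :=
  lt_of_lt_of_le one_pos N.one_le_modulus

lemma add_le_modulus (N : QuasiNorm 𝕜 X) (x y : X) : N (x + y) ≤ N.modulus * (N x + N y) :=
  (Classical.choose_spec N.add_le).2 x y

lemma map_zero (N : QuasiNorm 𝕜 X) : N 0 = 0 := (N.eq_zero_iff 0).2 rfl

lemma map_neg (N : QuasiNorm 𝕜 X) (x : X) : N (-x) = N x := by
  simpa using N.smul_eq (-1) x

lemma sub_le_modulus (N : QuasiNorm 𝕜 X) (x y : X) : N (x - y) ≤ N.modulus * (N x + N y) := by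
  simpa [sub_eq_add_neg, map_neg] using N.add_le_modulus x (-y)

end QuasiNorm

/-! ### Greedy orderings starting with a prescribed set -/

lemma exists_sorted_enumeration (w : ℕ → ℝ) (F : Finset ℕ) :
    ∃ σ : ℕ → ℕ, Set.InjOn σ (Finset.range F.card) ∧ (Finset.range F.card).image σ = F ∧
      ∀ i j, i ≤ j → j < F.card → w (σ j) ≤ w (σ i) := by
  induction F using Finset.induction_on_min_value w with
  | empty => exact ⟨id, by simp, by simp, by simp⟩
  | insert a s ha hmin ih =>
    obtain ⟨σ, hinj, him, hmono⟩ := ih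
    have hmem : ∀ i, i < s.card → σ i ∈ s := fun i hi => by
      rw [← him]; exact Finset.mem_image_of_mem _ (Finset.mem_range.2 hi)
    have hlt : ∀ i, i < s.card → Function.update σ s.card a i = σ i := fun i hi =>
      Function.update_of_ne hi.ne _ _
    have heq : Function.update σ s.card a s.card = a := Function.update_self ..
    refine ⟨Function.update σ s.card a, ?_, ?_, ?_⟩
    · rw [Finset.card_insert_of_notMem ha]
      intro i hi j hj hij
      simp only [Finset.coe_range, Set.mem_Iio, Nat.lt_succ_iff_lt_or_eq] at hi hj
      rcases hi with hi | rfl <;> rcases hj with hj | rfl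
      · rw [hlt i hi, hlt j hj] at hij
        exact hinj (by simpa using hi) (by simpa using hj) hij
      · rw [hlt i hi, heq] at hij
        exact absurd (hij ▸ hmem i hi) ha
      · rw [hlt j hj, heq] at hij
        exact absurd (hij ▸ hmem j hj) ha
      · rfl
    · rw [Finset.card_insert_of_notMem ha, Finset.range_add_one, Finset.image_insert, heq]
      congr 1
      exact (Finset.image_congr (g := σ) fun i hi => hlt i (by simpa using hi)).trans him
    · rw [Finset.card_insert_of_notMem ha]
      intro i j hij hj
      rcases Nat.lt_succ_iff_lt_or_eq.1 hj with hj | rfl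
      · rw [hlt i (by omega), hlt j hj]; exact hmono i j hij hj
      · rcases hij.lt_or_eq with hi | rfl
        · rw [hlt i hi, heq]; exact hmin _ (hmem i hi)
        · rfl

/-- Concatenate a sorted enumeration of `G`, a sorted enumeration of `F \ G` and the increasing
enumeration of the complement of `F`. The last block, where `w` vanishes, is there because an
ordering is an infinite injective sequence. -/
lemma exists_ordering_of_greedy (w : ℕ → ℝ) (F G : Finset ℕ) (hGF : G ⊆ F) (hw : ∀ n, 0 ≤ w n)
    (hF : ∀ n, n ∉ F → w n = 0) (hG : ∀ n ∈ G, ∀ k, k ∉ G → w k ≤ w n) :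
    ∃ π : ℕ → ℕ, Function.Injective π ∧ (∀ n, w n ≠ 0 → n ∈ Set.range π) ∧
      (∀ i j, i ≤ j → w (π j) ≤ w (π i)) ∧ (Finset.range G.card).image π = G := by
  obtain ⟨σ, hσi, hσ, hσm⟩ := exists_sorted_enumeration w G
  obtain ⟨τ, hτi, hτ, hτm⟩ := exists_sorted_enumeration w (F \ G)
  have hinf : {n | n ∉ F}.Infinite := F.finite_toSet.infinite_compl
  have hσmem : ∀ i, i < G.card → σ i ∈ G := fun i hi => by
    rw [← hσ]; exact Finset.mem_image_of_mem _ (Finset.mem_range.2 hi)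
  have hτmem : ∀ i, i < (F \ G).card → τ i ∈ F \ G := fun i hi => by
    rw [← hτ]; exact Finset.mem_image_of_mem _ (Finset.mem_range.2 hi)
  have hνmem : ∀ i, Nat.nth (fun n => n ∉ F) i ∉ F := fun i => Nat.nth_mem_of_infinite hinf i
  let π : ℕ → ℕ := fun i =>
    if i < G.card then σ i else
      if i < G.card + (F \ G).card then τ (i - G.card)
      else Nat.nth (fun n => n ∉ F) (i - (G.card + (F \ G).card))
  have h1 : ∀ i, i < G.card → π i = σ i := fun i hi => if_pos hi
  have h2 : ∀ i, ¬ i < G.card → i < G.card + (F \ G).card → π i = τ (i - G.card) :=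
    fun i hi hi' => by simp only [π, if_neg hi, if_pos hi']
  have h3 : ∀ i, ¬ i < G.card + (F \ G).card →
      π i = Nat.nth (fun n => n ∉ F) (i - (G.card + (F \ G).card)) :=
    fun i hi => by
      have : ¬ i < G.card := by omega
      simp only [π, if_neg hi, if_neg this]
  have c1 : ∀ i, i < G.card → π i ∈ G := fun i hi => h1 i hi ▸ hσmem i hi
  have c2 : ∀ i, ¬ i < G.card → i < G.card + (F \ G).card → π i ∈ F \ G :=
    fun i hi hi' => h2 i hi hi' ▸ hτmem _ (by omega)
  have c3 : ∀ i, ¬ i < G.card + (F \ G).card → π i ∉ F := fun i hi => h3 i hi ▸ hνmem _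
  have c23 : ∀ i, ¬ i < G.card → π i ∉ G := fun i hi => by
    by_cases hi' : i < G.card + (F \ G).card
    · exact (Finset.mem_sdiff.1 (c2 i hi hi')).2
    · exact fun h => c3 i hi' (hGF h)
  refine ⟨π, ?_, ?_, ?_, ?_⟩
  · have key : ∀ i j, i < j → π i ≠ π j := by
      intro i j hij h
      by_cases hi : i < G.card
      · by_cases hj : j < G.card
        · rw [h1 i hi, h1 j hj] at h
          exact hij.ne (hσi (by simpa using hi) (by simpa using hj) h)
        · exact c23 j hj (h ▸ c1 i hi)
      · have hj : ¬ j < G.card := by omega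
        by_cases hi' : i < G.card + (F \ G).card
        · by_cases hj' : j < G.card + (F \ G).card
          · rw [h2 i hi hi', h2 j hj hj'] at h
            have := hτi (by simp only [Finset.coe_range, Set.mem_Iio]; omega)
              (by simp only [Finset.coe_range, Set.mem_Iio]; omega) h
            omega
          · exact c3 j hj' (h ▸ (Finset.mem_sdiff.1 (c2 i hi hi')).1)
        · have hj' : ¬ j < G.card + (F \ G).card := by omega
          rw [h3 i hi', h3 j hj'] at h
          have := Nat.nth_injective hinf h
          omega
    intro i j h
    by_contra hne
    rcases Nat.lt_or_gt_of_ne hne with hlt | hlt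
    · exact key i j hlt h
    · exact key j i hlt h.symm
  · intro n hn
    have hnF : n ∈ F := by by_contra h; exact hn (hF n h)
    by_cases hnG : n ∈ G
    · rw [← hσ] at hnG
      obtain ⟨i, hi, rfl⟩ := Finset.mem_image.1 hnG
      exact ⟨i, h1 i (Finset.mem_range.1 hi)⟩
    · have hmem : n ∈ F \ G := Finset.mem_sdiff.2 ⟨hnF, hnG⟩
      rw [← hτ] at hmem
      obtain ⟨i, hi, rfl⟩ := Finset.mem_image.1 hmem
      have hi := Finset.mem_range.1 hi
      exact ⟨G.card + i, by rw [h2 _ (by omega) (by omega)]; congr 1; omega⟩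
  · intro i j hij
    by_cases hj' : j < G.card + (F \ G).card
    · by_cases hi : i < G.card
      · by_cases hj : j < G.card
        · rw [h1 i hi, h1 j hj]; exact hσm i j hij hj
        · exact hG _ (c1 i hi) _ (c23 j hj)
      · rw [h2 i hi (by omega), h2 j (by omega) hj']
        exact hτm _ _ (by omega) (by omega)
    · rw [hF _ (c3 j hj')]; exact hw _
  · conv_rhs => rw [← hσ]
    exact Finset.image_congr fun i hi => h1 i (by simpa using hi)

/-! ### Finitely supported vectors and greedy projections -/

namespace MBasis

variable {𝕜 X : Type*} [RCLike 𝕜] [AddCommGroup X] [Module 𝕜 X] {N : QuasiNorm 𝕜 X}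

section

variable (B : MBasis N)

lemma coord_indicatorSum (a : ℕ → 𝕜) (A : Finset ℕ) (k : ℕ) :
    B.coord k (B.indicatorSum a A) = if k ∈ A then a k else 0 := by
  simp [indicatorSum, map_sum, B.biorthogonal]

lemma indicatorSum_union {A D : Finset ℕ} (h : Disjoint A D) (a : ℕ → 𝕜) :
    B.indicatorSum a (A ∪ D) = B.indicatorSum a A + B.indicatorSum a D :=
  Finset.sum_union h

lemma indicatorSum_congr {A : Finset ℕ} {a b : ℕ → 𝕜} (h : ∀ n ∈ A, a n = b n) :
    B.indicatorSum a A = B.indicatorSum b A :=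
  Finset.sum_congr rfl fun n hn => by rw [h n hn]

lemma indicatorSum_sdiff_add {G A : Finset ℕ} (h : G ⊆ A) (a : ℕ → 𝕜) :
    B.indicatorSum a (A \ G) + B.indicatorSum a G = B.indicatorSum a A :=
  Finset.sum_sdiff h

lemma indicatorSum_add (a b : ℕ → 𝕜) (A : Finset ℕ) :
    B.indicatorSum (fun n => a n + b n) A = B.indicatorSum a A + B.indicatorSum b A := by
  simp [indicatorSum, add_smul, Finset.sum_add_distrib]

lemma indicatorSum_smul (t : 𝕜) (a : ℕ → 𝕜) (A : Finset ℕ) :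
    B.indicatorSum (fun n => t * a n) A = t • B.indicatorSum a A := by
  simp [indicatorSum, Finset.smul_sum, mul_smul]

lemma indicatorSum_empty (a : ℕ → 𝕜) : B.indicatorSum a ∅ = 0 := Finset.sum_empty

lemma norm_indicatorSum_real_mul {t : ℝ} (ht : 0 ≤ t) (a : ℕ → 𝕜) (A : Finset ℕ) :
    N (B.indicatorSum (fun n => (t : 𝕜) * a n) A) = t * N (B.indicatorSum a A) := by
  rw [indicatorSum_smul, N.smul_eq, RCLike.norm_ofReal, abs_of_nonneg ht]

lemma partialSum_eq (m : ℕ) (x : X) :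
    B.partialSum m x = B.indicatorSum (fun n => B.coord n x) (Finset.range m) := rfl

lemma greedySum_eq {π : ℕ → ℕ} (hπ : Function.Injective π) (m : ℕ) (x : X) :
    B.greedySum π m x =
      B.indicatorSum (fun n => B.coord n x) ((Finset.range m).image π) := by
  rw [indicatorSum, Finset.sum_image hπ.injOn]; rfl

lemma exists_greedyOrdering (a : ℕ → 𝕜) {A G : Finset ℕ} (hGA : G ⊆ A)
    (hG : ∀ n ∈ G, ∀ k ∈ A \ G, ‖a k‖ ≤ ‖a n‖) :
    ∃ π, B.IsGreedyOrdering (B.indicatorSum a A) π ∧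
      B.indicatorSum a A - B.greedySum π G.card (B.indicatorSum a A) =
        B.indicatorSum a (A \ G) := by
  obtain ⟨π, hinj, hsup, hmono, him⟩ := exists_ordering_of_greedy
    (fun n => ‖B.coord n (B.indicatorSum a A)‖) A G hGA (fun _ => norm_nonneg _)
    (fun n hn => by simp [coord_indicatorSum, hn]) (by
      intro n hn k hk
      simp only [coord_indicatorSum, if_pos (hGA hn)]
      split_ifs with hkA
      · exact hG n hn k (Finset.mem_sdiff.2 ⟨hkA, hk⟩)
      · simp)
  refine ⟨π, ⟨hinj, fun n hn => hsup n (norm_ne_zero_iff.2 hn), hmono⟩, ?_⟩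
  rw [greedySum_eq B hinj, him, B.indicatorSum_congr (A := G) (b := a)
    (fun n hn => by rw [coord_indicatorSum, if_pos (hGA hn)]), sub_eq_iff_eq_add,
    indicatorSum_sdiff_add B hGA]

/-- Since `gamma` is a supremum over all orderings, ties may be broken at will: any greedy set `G`
can be the one removed. -/
lemma le_gamma (a : ℕ → 𝕜) {A G : Finset ℕ} (hGA : G ⊆ A)
    (hG : ∀ n ∈ G, ∀ k ∈ A \ G, ‖a k‖ ≤ ‖a n‖) :
    ENNReal.ofReal (N (B.indicatorSum a (A \ G))) ≤ B.gamma G.card (B.indicatorSum a A) := by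
  obtain ⟨π, hπ, h⟩ := B.exists_greedyOrdering a hGA hG
  rw [← h]
  exact le_iSup₂ (f := fun (π : ℕ → ℕ) (_ : B.IsGreedyOrdering (B.indicatorSum a A) π) =>
    ENNReal.ofReal (N (B.indicatorSum a A - B.greedySum π G.card (B.indicatorSum a A)))) π hπ

/-- Projections of finitely supported vectors onto greedy sets and their complements are
bounded by `C`. -/
def GreedyProjBound (C : ℝ) : Prop :=
  ∀ (a : ℕ → 𝕜) (A G : Finset ℕ), G ⊆ A → (∀ n ∈ G, ∀ k ∈ A \ G, ‖a k‖ ≤ ‖a n‖) →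
    N (B.indicatorSum a G) ≤ C * N (B.indicatorSum a A) ∧
      N (B.indicatorSum a (A \ G)) ≤ C * N (B.indicatorSum a A)

end

variable {B : MBasis N}

lemma IsQuasiGreedy.exists_greedyProjBound (hB : B.IsQuasiGreedy) :
    ∃ C : ℝ, 1 ≤ C ∧ B.GreedyProjBound C := by
  obtain ⟨C, hC, h⟩ := hB
  have hκ := N.one_le_modulus
  have hC' : C ≤ N.modulus * (1 + C) := by nlinarith
  have h1' : 1 ≤ N.modulus * (1 + C) := by nlinarith
  refine ⟨N.modulus * (1 + C), h1', fun a A G hGA hG => ?_⟩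
  have hx := N.nonneg (B.indicatorSum a A)
  rcases G.eq_empty_or_nonempty with rfl | hne
  · simp only [indicatorSum_empty, N.map_zero, Finset.sdiff_empty]
    exact ⟨by positivity, le_mul_of_one_le_left hx h1'⟩
  have h1 : N (B.indicatorSum a (A \ G)) ≤ C * N (B.indicatorSum a A) :=
    (ENNReal.ofReal_le_ofReal_iff (by positivity)).1
      ((B.le_gamma a hGA hG).trans (h _ hne.card_pos _))
  refine ⟨?_, h1.trans (mul_le_mul_of_nonneg_right hC' hx)⟩
  have h2 : B.indicatorSum a G = B.indicatorSum a A - B.indicatorSum a (A \ G) := by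
    rw [← indicatorSum_sdiff_add B hGA]; abel
  rw [h2, mul_assoc]
  refine (N.sub_le_modulus _ _).trans (mul_le_mul_of_nonneg_left ?_ N.modulus_pos.le)
  linarith

/-! ### Comparing general coefficients with signs -/

lemma GreedyProjBound.indicator_le {C : ℝ} (h : B.GreedyProjBound C) {ε : ℕ → 𝕜}
    {D A : Finset ℕ} (hDA : D ⊆ A) (hε : ∀ n ∈ A, ‖ε n‖ = 1) :
    N (B.indicatorSum ε D) ≤ C * N (B.indicatorSum ε A) :=
  -- All coefficients have modulus one, so every subset of `A` is a greedy set.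
  (h ε A D hDA fun n hn k hk => by
    rw [hε n (hDA hn), hε k (Finset.sdiff_subset hk)]).1

/-- The bound may depend on `A`; it only serves to make the supremum in `exists_convex_le` finite,
so that it can be absorbed. -/
lemma exists_indicatorSum_le (B : MBasis N) (A : Finset ℕ) :
    ∃ R : ℝ, ∀ a : ℕ → 𝕜, (∀ n ∈ A, ‖a n‖ ≤ 1) → N (B.indicatorSum a A) ≤ R := by
  induction A using Finset.induction_on with
  | empty => exact ⟨0, fun a _ => by rw [indicatorSum_empty, N.map_zero]⟩
  | insert k A hk ih =>
    obtain ⟨R, hR⟩ := ih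
    refine ⟨N.modulus * (N (B.e k) + R), fun a ha => ?_⟩
    rw [indicatorSum, Finset.sum_insert hk]
    refine (N.add_le_modulus _ _).trans (mul_le_mul_of_nonneg_left (add_le_add ?_
      (hR a fun n hn => ha n (Finset.mem_insert_of_mem hn))) N.modulus_pos.le)
    rw [N.smul_eq]
    exact mul_le_of_le_one_left (N.nonneg _) (ha k (Finset.mem_insert_self _ _))

lemma GreedyProjBound.exists_nat_mul_le {C : ℝ} (hC : 1 ≤ C) (h : B.GreedyProjBound C) (j : ℕ) :
    ∃ K : ℝ, 0 ≤ K ∧ ∀ (A : Finset ℕ) (ε : ℕ → 𝕜) (d : ℕ → ℕ), (∀ n ∈ A, ‖ε n‖ = 1) →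
      (∀ n ∈ A, d n ≤ j) →
        N (B.indicatorSum (fun n => (d n : 𝕜) * ε n) A) ≤ K * N (B.indicatorSum ε A) := by
  induction j with
  | zero =>
    refine ⟨0, le_rfl, fun A ε d _ hd => ?_⟩
    have : B.indicatorSum (fun n => (d n : 𝕜) * ε n) A = 0 :=
      Finset.sum_eq_zero fun n hn => by simp [Nat.le_zero.1 (hd n hn)]
    rw [this, N.map_zero, zero_mul]
  | succ j ih =>
    obtain ⟨K, hK, hj⟩ := ih
    have hκ := N.modulus_pos
    refine ⟨N.modulus * (K + C), by positivity, fun A ε d hε hd => ?_⟩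
    -- Peel off the top layer: capping `d` at `j` loses exactly one copy of `ε` on `{d = j + 1}`.
    have hsplit : B.indicatorSum (fun n => (d n : 𝕜) * ε n) A =
        B.indicatorSum (fun n => ((min (d n) j : ℕ) : 𝕜) * ε n) A +
          B.indicatorSum ε (A.filter fun n => d n = j + 1) := by
      simp only [indicatorSum, Finset.sum_filter, ← Finset.sum_add_distrib]
      refine Finset.sum_congr rfl fun n hn => ?_
      split_ifs with hdn
      · rw [hdn, Nat.min_eq_right (Nat.le_succ j)]
        push_cast
        rw [add_mul, one_mul, add_smul]
      · have := hd n hn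
        rw [Nat.min_eq_left (by omega), add_zero]
    rw [hsplit, mul_assoc, add_mul]
    exact (N.add_le_modulus _ _).trans (mul_le_mul_of_nonneg_left (add_le_add
      (hj A ε _ hε fun n _ => min_le_right _ _)
      (h.indicator_le (Finset.filter_subset _ _) hε)) hκ.le)

/-- Averaging over subsets is unavailable without local convexity. Instead, write `s = ⌊b s⌋ / b +
(fractional part of b s) / b`: the first term has boundedly many integer levels, the second is `1 /
b` times a vector of the same kind. With `b ≥ 2κ`, `κ` the modulus, the supremum over all such
vectors is at most a multiple of `‖1_{εA}‖` plus half of itself. -/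
lemma GreedyProjBound.exists_convex_le {C : ℝ} (hC : 1 ≤ C) (h : B.GreedyProjBound C) :
    ∃ K : ℝ, 1 ≤ K ∧ ∀ (A : Finset ℕ) (ε : ℕ → 𝕜) (r : ℕ → ℝ), (∀ n ∈ A, ‖ε n‖ = 1) →
      (∀ n ∈ A, 0 ≤ r n ∧ r n ≤ 1) →
        N (B.indicatorSum (fun n => (r n : 𝕜) * ε n) A) ≤ K * N (B.indicatorSum ε A) := by
  have hκ := N.modulus_pos
  obtain ⟨b, hb⟩ := exists_nat_ge (2 * N.modulus)
  have hb0 : (0 : ℝ) < b := by linarith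
  obtain ⟨K, hK, hnat⟩ := h.exists_nat_mul_le hC b
  refine ⟨2 * (N.modulus * K) + 1, by nlinarith [mul_nonneg hκ.le hK], fun A ε r hε hr => ?_⟩
  set M := N (B.indicatorSum ε A) with hM
  have hM0 : 0 ≤ M := N.nonneg _
  let S : Set ℝ := {t | ∃ r : ℕ → ℝ, (∀ n ∈ A, 0 ≤ r n ∧ r n ≤ 1) ∧
    N (B.indicatorSum (fun n => (r n : 𝕜) * ε n) A) = t}
  have hbdd : BddAbove S := by
    obtain ⟨R, hR⟩ := B.exists_indicatorSum_le A
    refine ⟨R, ?_⟩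
    rintro t ⟨r, hr, rfl⟩
    refine hR _ fun n hn => ?_
    rw [norm_mul, hε n hn, mul_one, RCLike.norm_ofReal, abs_of_nonneg (hr n hn).1]
    exact (hr n hn).2
  have hsup : sSup S ≤ N.modulus * K * M + sSup S / 2 := by
    refine csSup_le ⟨_, r, hr, rfl⟩ ?_
    rintro t ⟨s, hs, rfl⟩
    have hfl : ∀ n ∈ A, (⌊b * s n⌋₊ : ℝ) ≤ b * s n ∧ b * s n < ⌊b * s n⌋₊ + 1 := fun n hn =>
      ⟨Nat.floor_le (mul_nonneg hb0.le (hs n hn).1), Nat.lt_floor_add_one _⟩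
    have e1 : B.indicatorSum (fun n => (s n : 𝕜) * ε n) A =
        B.indicatorSum (fun n => ((1 / b : ℝ) : 𝕜) * ((⌊b * s n⌋₊ : 𝕜) * ε n)) A +
        B.indicatorSum (fun n => ((1 / b : ℝ) : 𝕜) * (((b * s n - ⌊b * s n⌋₊ : ℝ) : 𝕜) * ε n)) A
        := by
      rw [← indicatorSum_add]
      refine B.indicatorSum_congr fun n _ => ?_
      have : (b : 𝕜) ≠ 0 := by exact_mod_cast hb0.ne'
      push_cast
      field_simp
      ring
    rw [e1]
    refine (N.add_le_modulus _ _).trans ?_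
    rw [norm_indicatorSum_real_mul B (by positivity), norm_indicatorSum_real_mul B (by positivity)]
    have h1 := hnat A ε (fun n => ⌊b * s n⌋₊) hε fun n hn => Nat.floor_le_of_le
      (mul_le_of_le_one_right hb0.le (hs n hn).2)
    have h2 : N (B.indicatorSum (fun n => ((b * s n - ⌊b * s n⌋₊ : ℝ) : 𝕜) * ε n) A) ≤ sSup S :=
      le_csSup hbdd ⟨_, fun n hn => ⟨by linarith [(hfl n hn).1], by linarith [(hfl n hn).2]⟩, rfl⟩
    have h3 : 0 ≤ sSup S := (N.nonneg _).trans h2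
    rw [mul_add]
    refine add_le_add ?_ ?_
    · rw [mul_assoc]
      refine mul_le_mul_of_nonneg_left ?_ hκ.le
      refine le_trans ?_ h1
      refine mul_le_of_le_one_left (N.nonneg _) ?_
      rw [div_le_one hb0]
      nlinarith [N.one_le_modulus]
    · calc _ ≤ N.modulus * (1 / b * sSup S) := by gcongr
        _ = (N.modulus / b) * sSup S := by ring
        _ ≤ (1 / 2) * sSup S := by
            refine mul_le_mul_of_nonneg_right ?_ h3
            rw [div_le_div_iff₀ hb0 two_pos]
            linarith
        _ = sSup S / 2 := by ring
  have hle : N (B.indicatorSum (fun n => (r n : 𝕜) * ε n) A) ≤ sSup S := le_csSup hbdd ⟨r, hr, rfl⟩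
  nlinarith

/-- One step of the comparison of `1_{εA}` with vectors whose coefficients have modulus at least
one: the coefficients above the level `Λ` are split off. -/
lemma GreedyProjBound.indicator_le_of_split {C Λ K L : ℝ} (h : B.GreedyProjBound C)
    (hΛ : 0 < Λ) (hK : 0 ≤ K) (hL : 0 ≤ L)
    {A : Finset ℕ} {ε : ℕ → 𝕜} {r : ℕ → ℝ} (hε : ∀ n ∈ A, ‖ε n‖ = 1) (hr : ∀ n ∈ A, 1 ≤ r n)
    (hlow : N (B.indicatorSum ε (A \ A.filter fun n => Λ < r n)) ≤
      K * N (B.indicatorSum (fun n => (r n : 𝕜) * ε n) (A \ A.filter fun n => Λ < r n)))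
    (hhigh : N (B.indicatorSum ε (A.filter fun n => Λ < r n)) ≤
      L * N (B.indicatorSum (fun n => ((r n / Λ : ℝ) : 𝕜) * ε n) (A.filter fun n => Λ < r n))) :
    N (B.indicatorSum ε A) ≤ N.modulus * (K * C + L * (C / Λ)) *
      N (B.indicatorSum (fun n => (r n : 𝕜) * ε n) A) := by
  set G := A.filter fun n => Λ < r n with hG
  have hGA : G ⊆ A := Finset.filter_subset _ _
  have hnorm : ∀ n ∈ A, ‖(r n : 𝕜) * ε n‖ = r n := fun n hn => by
    rw [norm_mul, hε n hn, mul_one, RCLike.norm_ofReal, abs_of_nonneg (by linarith [hr n hn])]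
  obtain ⟨h1, h2⟩ := h (fun n => (r n : 𝕜) * ε n) A G hGA fun n hn k hk => by
    rw [hnorm n (hGA hn), hnorm k (Finset.sdiff_subset hk)]
    have h1 := (Finset.mem_filter.1 hn).2
    have h2 : ¬ Λ < r k := fun h' => (Finset.mem_sdiff.1 hk).2
      (Finset.mem_filter.2 ⟨Finset.sdiff_subset hk, h'⟩)
    linarith
  have e : B.indicatorSum (fun n => ((r n / Λ : ℝ) : 𝕜) * ε n) G =
      B.indicatorSum (fun n => ((1 / Λ : ℝ) : 𝕜) * ((r n : 𝕜) * ε n)) G :=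
    B.indicatorSum_congr fun n _ => by push_cast; ring
  rw [e, norm_indicatorSum_real_mul B (by positivity)] at hhigh
  rw [← indicatorSum_sdiff_add B hGA ε, mul_assoc, add_mul]
  refine (N.add_le_modulus _ _).trans (mul_le_mul_of_nonneg_left (add_le_add ?_ ?_)
    N.modulus_pos.le)
  · rw [mul_assoc]; exact hlow.trans (mul_le_mul_of_nonneg_left h2 hK)
  · rw [mul_assoc]
    refine hhigh.trans (mul_le_mul_of_nonneg_left ?_ hL)
    calc _ ≤ 1 / Λ * (C * N (B.indicatorSum (fun n => (r n : 𝕜) * ε n) A)) := by gcongr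
      _ = _ := by ring

/-- The vectors differ by `δ` times one with coefficients in `[0,1]`, whose norm is at most `K
‖1_{εA}‖`. The choice `δ = 1 / (2κK)`, `κ` the modulus, makes this difference absorbable in the
left-hand side. -/
lemma GreedyProjBound.exists_indicator_le_near_one {C : ℝ} (hC : 1 ≤ C)
    (h : B.GreedyProjBound C) :
    ∃ lam : ℝ, 1 < lam ∧ ∀ (A : Finset ℕ) (ε : ℕ → 𝕜) (r : ℕ → ℝ),
      (∀ n ∈ A, ‖ε n‖ = 1) → (∀ n ∈ A, 1 ≤ r n ∧ r n ≤ lam) →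
        N (B.indicatorSum ε A) ≤
          2 * N.modulus * N (B.indicatorSum (fun n => (r n : 𝕜) * ε n) A) := by
  obtain ⟨K, hK, hconv⟩ := h.exists_convex_le hC
  have hκ := N.modulus_pos
  set δ : ℝ := 1 / (2 * N.modulus * K) with hδ
  have hδ0 : 0 < δ := by positivity
  refine ⟨1 + δ, by linarith, fun A ε r hε hr => ?_⟩
  have e : B.indicatorSum ε A = B.indicatorSum (fun n => (r n : 𝕜) * ε n) A -
      B.indicatorSum (fun n => (δ : 𝕜) * ((((r n - 1) / δ : ℝ) : 𝕜) * ε n)) A := by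
    rw [eq_sub_iff_add_eq, ← indicatorSum_add]
    refine B.indicatorSum_congr fun n _ => ?_
    have : (δ : 𝕜) ≠ 0 := by exact_mod_cast hδ0.ne'
    push_cast
    field_simp
    ring
  have h1 : N (B.indicatorSum (fun n => (((r n - 1) / δ : ℝ) : 𝕜) * ε n) A) ≤
      K * N (B.indicatorSum ε A) := hconv A ε _ hε fun n hn =>
    ⟨div_nonneg (by linarith [(hr n hn).1]) hδ0.le, by
      rw [div_le_one hδ0]; linarith [(hr n hn).2]⟩
  have h2 := N.sub_le_modulus (B.indicatorSum (fun n => (r n : 𝕜) * ε n) A)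
    (B.indicatorSum (fun n => (δ : 𝕜) * ((((r n - 1) / δ : ℝ) : 𝕜) * ε n)) A)
  rw [← e, norm_indicatorSum_real_mul B hδ0.le] at h2
  have h3 : N.modulus * (δ * (K * N (B.indicatorSum ε A))) = N (B.indicatorSum ε A) / 2 := by
    rw [hδ]; field_simp
  have h4 := mul_le_mul_of_nonneg_left (mul_le_mul_of_nonneg_left h1 hδ0.le) hκ.le
  nlinarith

/-- Induction over the levels `lam ^ j`: coefficients up to `lam` fall under the previous lemma, and
the others drop one level after division by `lam`. The constant grows with `j`, which is harmless
for fixed `Λ`. -/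
lemma GreedyProjBound.exists_indicator_le_bounded {C : ℝ} (hC : 1 ≤ C)
    (h : B.GreedyProjBound C) (Λ : ℝ) :
    ∃ K : ℝ, 0 ≤ K ∧ ∀ (A : Finset ℕ) (ε : ℕ → 𝕜) (r : ℕ → ℝ),
      (∀ n ∈ A, ‖ε n‖ = 1) → (∀ n ∈ A, 1 ≤ r n ∧ r n ≤ Λ) →
        N (B.indicatorSum ε A) ≤ K * N (B.indicatorSum (fun n => (r n : 𝕜) * ε n) A) := by
  obtain ⟨lam, hlam, hnear⟩ := h.exists_indicator_le_near_one hC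
  have hκ := N.modulus_pos
  have hlam0 : 0 < lam := by linarith
  have key : ∀ j : ℕ, ∃ K : ℝ, 0 ≤ K ∧ ∀ (A : Finset ℕ) (ε : ℕ → 𝕜) (r : ℕ → ℝ),
      (∀ n ∈ A, ‖ε n‖ = 1) → (∀ n ∈ A, 1 ≤ r n ∧ r n ≤ lam ^ j) →
        N (B.indicatorSum ε A) ≤ K * N (B.indicatorSum (fun n => (r n : 𝕜) * ε n) A) := by
    intro j
    induction j with
    | zero =>
      refine ⟨2 * N.modulus, by positivity, fun A ε r hε hr => hnear A ε r hε fun n hn => ?_⟩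
      have := hr n hn
      rw [pow_zero] at this
      exact ⟨this.1, by linarith⟩
    | succ j ih =>
      obtain ⟨K, hK, hj⟩ := ih
      refine ⟨N.modulus * (2 * N.modulus * C + K * (C / lam)), by positivity,
        fun A ε r hε hr => ?_⟩
      refine h.indicator_le_of_split hlam0 (by positivity) hK hε (fun n hn => (hr n hn).1)
        (hnear _ _ _ (fun n hn => hε n (Finset.sdiff_subset hn)) fun n hn => ?_)
        (hj _ _ _ (fun n hn => hε n (Finset.filter_subset _ _ hn)) fun n hn => ?_)
      · simp only [Finset.mem_sdiff, Finset.mem_filter, not_and, not_lt] at hn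
        exact ⟨(hr n hn.1).1, hn.2 hn.1⟩
      · obtain ⟨hnA, hn⟩ := Finset.mem_filter.1 hn
        exact ⟨(one_le_div hlam0).2 hn.le, (div_le_iff₀ hlam0).2 ((hr n hnA).2.trans_eq
          (pow_succ _ _))⟩
  obtain ⟨j, hj⟩ := pow_unbounded_of_one_lt Λ hlam
  obtain ⟨K, hK, hK'⟩ := key j
  exact ⟨K, hK, fun A ε r hε hr => hK' A ε r hε fun n hn =>
    ⟨(hr n hn).1, (hr n hn).2.trans hj.le⟩⟩

/-- Quasi-greedy bases are truncation quasi-greedy. -/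
lemma GreedyProjBound.exists_indicator_le_of_one_le {C : ℝ} (hC : 1 ≤ C)
    (h : B.GreedyProjBound C) :
    ∃ K : ℝ, 0 ≤ K ∧ ∀ (A : Finset ℕ) (ε : ℕ → 𝕜) (r : ℕ → ℝ),
      (∀ n ∈ A, ‖ε n‖ = 1) → (∀ n ∈ A, 1 ≤ r n) →
        N (B.indicatorSum ε A) ≤ K * N (B.indicatorSum (fun n => (r n : 𝕜) * ε n) A) := by
  have hκ := N.one_le_modulus
  -- With `Λ = 2κC`, `κ` the modulus, the part above level `Λ` contributes `κ K C / Λ = K / 2`, and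
  -- `K` is chosen so that the part below contributes the other half. Thus `hstep` reproduces `K`,
  -- and the induction on `j` does not lose constants.
  set Λ : ℝ := 2 * N.modulus * C with hΛ
  have hΛ1 : 1 < Λ := by nlinarith
  have hΛ0 : 0 < Λ := by linarith
  obtain ⟨K₀, hK₀, hbd⟩ := h.exists_indicator_le_bounded hC Λ
  set K := 2 * (N.modulus * (K₀ * C)) with hKdef
  have hK0 : 0 ≤ K := by positivity
  have hK₀K : K₀ ≤ K := by
    nlinarith [mul_nonneg hK₀ (sub_nonneg.2 hC),
      mul_nonneg (mul_nonneg hK₀ (by linarith : 0 ≤ C)) (sub_nonneg.2 hκ)]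
  have hstep : N.modulus * (K₀ * C + K * (C / Λ)) = K := by
    have : C / Λ = 1 / (2 * N.modulus) := by rw [hΛ]; field_simp
    rw [this, hKdef]; field_simp; ring
  have key : ∀ j : ℕ, ∀ (A : Finset ℕ) (ε : ℕ → 𝕜) (r : ℕ → ℝ),
      (∀ n ∈ A, ‖ε n‖ = 1) → (∀ n ∈ A, 1 ≤ r n ∧ r n ≤ Λ ^ j) →
        N (B.indicatorSum ε A) ≤ K * N (B.indicatorSum (fun n => (r n : 𝕜) * ε n) A) := by
    intro j
    induction j with
    | zero =>
      refine fun A ε r hε hr => (hbd A ε r hε fun n hn => ?_).trans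
        (mul_le_mul_of_nonneg_right hK₀K (N.nonneg _))
      have := hr n hn
      rw [pow_zero] at this
      exact ⟨this.1, by linarith⟩
    | succ j ih =>
      intro A ε r hε hr
      rw [← hstep]
      refine h.indicator_le_of_split hΛ0 hK₀ hK0 hε (fun n hn => (hr n hn).1)
        (hbd _ _ _ (fun n hn => hε n (Finset.sdiff_subset hn)) fun n hn => ?_)
        (ih _ _ _ (fun n hn => hε n (Finset.filter_subset _ _ hn)) fun n hn => ?_)
      · simp only [Finset.mem_sdiff, Finset.mem_filter, not_and, not_lt] at hn
        exact ⟨(hr n hn.1).1, hn.2 hn.1⟩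
      · obtain ⟨hnA, hn⟩ := Finset.mem_filter.1 hn
        exact ⟨(one_le_div hΛ0).2 hn.le, (div_le_iff₀ hΛ0).2 ((hr n hnA).2.trans_eq
          (pow_succ _ _))⟩
  refine ⟨K, hK0, fun A ε r hε hr => ?_⟩
  -- The sum is just a convenient upper bound for all `r n`; its size is irrelevant since `K` does
  -- not depend on `j`.
  obtain ⟨j, hj⟩ := pow_unbounded_of_one_lt (∑ n ∈ A, r n) hΛ1
  exact key j A ε r hε fun n hn => ⟨hr n hn, (Finset.single_le_sum
    (fun k hk => zero_le_one.trans (hr k hk)) hn).trans hj.le⟩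

end MBasis
end GreedyApprox

/-! ### Super-conservativity implies partial greediness -/

namespace GreedyApprox
namespace MBasis

variable {𝕜 X : Type*} [RCLike 𝕜] [AddCommGroup X] [Module 𝕜 X] {N : QuasiNorm 𝕜 X}

/-- Super-conservativity: indicator sums are dominated by the indicator sums of the same length
that lie to the right of them. -/
def IsSuperConservative (B : MBasis N) : Prop :=
  ∃ C : ℝ, 0 ≤ C ∧ ∀ (A D : Finset ℕ) (ε δ : ℕ → 𝕜), A.card = D.card →
    (∀ n ∈ A, ∀ k ∈ D, n < k) → (∀ n ∈ A, ‖ε n‖ = 1) → (∀ n ∈ D, ‖δ n‖ = 1) →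
      N (B.indicatorSum ε A) ≤ C * N (B.indicatorSum δ D)

variable {B : MBasis N}

lemma coord_sub_partialSum (B : MBasis N) (m : ℕ) (x : X) (k : ℕ) :
    B.coord k (x - B.partialSum m x) = if k < m then 0 else B.coord k x := by
  rw [map_sub, partialSum_eq, coord_indicatorSum]
  simp only [Finset.mem_range]
  split_ifs <;> simp

/-- Discarding from `π` the terms below `m` leaves a greedy ordering of the tail of `x`. The
surviving part of the first `m` terms is an initial segment of it, so it is a greedy set of the
tail. -/
lemma IsGreedyOrdering.exists_tail {x : X} {π : ℕ → ℕ} (hπ : B.IsGreedyOrdering x π) (m : ℕ) :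
    ∃ π', B.IsGreedyOrdering (x - B.partialSum m x) π' ∧
      B.greedySum π' (((Finset.range m).image π).filter (m ≤ ·)).card (x - B.partialSum m x) =
        B.indicatorSum (fun n => B.coord n x) (((Finset.range m).image π).filter (m ≤ ·)) := by
  obtain ⟨hinj, hsup, hmono⟩ := hπ
  let p : ℕ → Prop := fun i => m ≤ π i
  have hinf : {i | p i}.Infinite := by
    have h1 : (π ⁻¹' (Set.Iio m)).Finite := (Set.finite_Iio m).preimage hinj.injOn
    have h2 : {i | p i} = (π ⁻¹' (Set.Iio m))ᶜ := by
      ext i; simp [p]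
    rw [h2]
    exact h1.infinite_compl
  have hp : ∀ j, m ≤ π (Nat.nth p j) := fun j => Nat.nth_mem_of_infinite hinf j
  have hco : ∀ j, B.coord (π (Nat.nth p j)) (x - B.partialSum m x) =
      B.coord (π (Nat.nth p j)) x := fun j => by
    rw [coord_sub_partialSum, if_neg (by have := hp j; omega)]
  have hinj' : Function.Injective (fun j => π (Nat.nth p j)) :=
    hinj.comp (Nat.nth_injective hinf)
  have hcard : (((Finset.range m).image π).filter (m ≤ ·)).card = Nat.count p m := by
    rw [Nat.count_eq_card_filter_range, Finset.filter_image, Finset.card_image_of_injective _ hinj]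
  have him : (Finset.range (Nat.count p m)).image (fun j => π (Nat.nth p j)) =
      ((Finset.range m).image π).filter (m ≤ ·) := by
    ext n
    simp only [Finset.mem_image, Finset.mem_range, Finset.mem_filter]
    constructor
    · rintro ⟨j, hj, rfl⟩
      exact ⟨⟨_, Nat.nth_lt_of_lt_count hj, rfl⟩, hp j⟩
    · rintro ⟨⟨i, hi, rfl⟩, hi'⟩
      exact ⟨Nat.count p i, Nat.count_strict_mono (p := p) hi' hi, by rw [Nat.nth_count (p := p) hi']⟩
  refine ⟨fun j => π (Nat.nth p j), ⟨hinj', fun n hn => ?_, fun i j hij => ?_⟩, ?_⟩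
  · simp only [Set.mem_ofPred_eq, coord_sub_partialSum, ne_eq, ite_eq_left_iff, not_lt,
      Classical.not_imp] at hn
    obtain ⟨i, rfl⟩ := hsup hn.2
    exact ⟨Nat.count p i, by simp only [Nat.nth_count (p := p) hn.1]⟩
  · rw [hco, hco]
    exact hmono _ _ ((Nat.nth_le_nth hinf).2 hij)
  · rw [greedySum_eq B hinj', hcard, him]
    refine B.indicatorSum_congr fun n hn => ?_
    rw [coord_sub_partialSum, if_neg (by simpa using (Finset.mem_filter.1 hn).2)]

/-- Normalize by the smallest modulus `t` on `D`. The coefficients on `A` then lie in `[0,1]` and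
those on `D` are at least `1`, so both can be replaced by signs. -/
lemma IsSuperConservative.exists_compare {C : ℝ} (hC : 1 ≤ C) (h : B.GreedyProjBound C)
    (hsc : B.IsSuperConservative) :
    ∃ K : ℝ, 0 ≤ K ∧ ∀ (A D : Finset ℕ) (a : ℕ → 𝕜), A.card = D.card →
      (∀ n ∈ A, ∀ k ∈ D, n < k) → (∀ n ∈ A, ∀ k ∈ D, ‖a n‖ ≤ ‖a k‖) →
        N (B.indicatorSum a A) ≤ K * N (B.indicatorSum a D) := by
  obtain ⟨K₀, hK₀, hsc⟩ := hsc
  obtain ⟨K₁, hK₁, hconv⟩ := h.exists_convex_le hC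
  obtain ⟨K₂, hK₂, htr⟩ := h.exists_indicator_le_of_one_le hC
  refine ⟨K₁ * K₀ * K₂, by positivity, fun A D a hcard hlt hle => ?_⟩
  have hrhs : 0 ≤ K₁ * K₀ * K₂ * N (B.indicatorSum a D) :=
    mul_nonneg (by positivity) (N.nonneg _)
  rcases D.eq_empty_or_nonempty with rfl | hD
  · have : A = ∅ := Finset.card_eq_zero.1 (by simpa using hcard)
    subst this
    rwa [indicatorSum_empty, N.map_zero] at *
  obtain ⟨d, hd, hmin⟩ := Finset.exists_min_image D (fun n => ‖a n‖) hD
  rcases (norm_nonneg (a d)).eq_or_lt with h0 | ht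
  · have : B.indicatorSum a A = 0 := Finset.sum_eq_zero fun n hn => by
      have : ‖a n‖ ≤ 0 := h0 ▸ hle n hn d hd
      rw [norm_le_zero_iff.1 this, zero_smul]
    rwa [this, N.map_zero]
  set t := ‖a d‖ with htdef
  -- Signs of `a`, with the value `1` where `a` vanishes so that `ε` is unimodular everywhere.
  let ε : ℕ → 𝕜 := fun n => if a n = 0 then 1 else a n / (‖a n‖ : 𝕜)
  have hε : ∀ n, ‖ε n‖ = 1 := fun n => by
    simp only [ε]
    split_ifs with hn
    · simp
    · rw [norm_div, RCLike.norm_ofReal, abs_norm, div_self (norm_ne_zero_iff.2 hn)]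
  have hscale : ∀ F, N (B.indicatorSum a F) =
      t * N (B.indicatorSum (fun n => ((‖a n‖ / t : ℝ) : 𝕜) * ε n) F) := fun F => by
    rw [← norm_indicatorSum_real_mul B ht.le]
    congr 1
    refine B.indicatorSum_congr fun n _ => ?_
    have ht' : (t : 𝕜) ≠ 0 := by exact_mod_cast ht.ne'
    simp only [ε]
    split_ifs with hn
    · simp [hn]
    · have : (‖a n‖ : 𝕜) ≠ 0 := by exact_mod_cast norm_ne_zero_iff.2 hn
      push_cast
      field_simp
  rw [hscale A, hscale D]
  have h1 := hconv A ε (fun n => ‖a n‖ / t) (fun n _ => hε n) fun n hn =>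
    ⟨by positivity, (div_le_one ht).2 (hle n hn d hd)⟩
  have h2 := hsc A D ε ε hcard hlt (fun n _ => hε n) (fun n _ => hε n)
  have h3 := htr D ε (fun n => ‖a n‖ / t) (fun n _ => hε n) fun n hn =>
    (one_le_div ht).2 (hmin n hn)
  calc _ ≤ t * (K₁ * (K₀ * (K₂ * _))) := by
        refine mul_le_mul_of_nonneg_left (h1.trans ?_) ht.le
        exact mul_le_mul_of_nonneg_left (h2.trans (mul_le_mul_of_nonneg_left h3 hK₀))
          (by linarith)
    _ = _ := by ring

/-- Quasi-greedy super-conservative bases are partially greedy. -/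
lemma IsSuperConservative.isPartiallyGreedy (hsc : B.IsSuperConservative)
    (hB : B.IsQuasiGreedy) : B.IsPartiallyGreedy := by
  obtain ⟨C, hC, h⟩ := hB.exists_greedyProjBound
  obtain ⟨K, hK, hcomp⟩ := hsc.exists_compare hC h
  obtain ⟨Q, hQ, hq⟩ := hB
  have hκ := N.modulus_pos
  refine ⟨N.modulus * ((Q + 1) + K * (N.modulus * (1 + (Q + 1)))), by positivity,
    fun m _ x => iSup₂_le fun π hπ => ?_⟩
  rw [beta, ← ENNReal.ofReal_mul (by positivity)]
  refine ENNReal.ofReal_le_ofReal ?_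
  obtain ⟨π', hπ', hsum⟩ := hπ.exists_tail m
  set a : ℕ → 𝕜 := fun n => B.coord n x with ha
  set G := (Finset.range m).image π with hG
  set D := G.filter (m ≤ ·) with hD
  set y := x - B.partialSum m x with hy
  have hy0 := N.nonneg y
  have hyD : N (y - B.indicatorSum a D) ≤ (Q + 1) * N y := by
    rcases D.eq_empty_or_nonempty with h0 | hne
    · rw [h0, indicatorSum_empty, sub_zero]; nlinarith
    · have h1 : ENNReal.ofReal (N (y - B.greedySum π' D.card y)) ≤ ENNReal.ofReal (Q * N y) :=
        (le_iSup₂ (f := fun (π : ℕ → ℕ) (_ : B.IsGreedyOrdering y π) =>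
          ENNReal.ofReal (N (y - B.greedySum π D.card y))) π' hπ').trans
          (hq _ hne.card_pos y)
      rw [hsum] at h1
      have := (ENNReal.ofReal_le_ofReal_iff (by positivity)).1 h1
      nlinarith
  have hDy : N (B.indicatorSum a D) ≤ N.modulus * (1 + (Q + 1)) * N y := by
    have e : B.indicatorSum a D = y - (y - B.indicatorSum a D) := by abel
    rw [e, mul_assoc]
    exact (N.sub_le_modulus _ _).trans (mul_le_mul_of_nonneg_left (by linarith) hκ.le)
  have hGm : G \ D = G ∩ Finset.range m := by
    ext n; simp [hD]; tauto
  -- Both `G` and `Finset.range m` have `m` elements, so their differences have equal size.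
  have hcard : (Finset.range m \ G).card = D.card := by
    have h1 := Finset.card_sdiff_add_card_inter (Finset.range m) G
    have h2 := Finset.card_sdiff_add_card_inter G (Finset.range m)
    have h3 : G \ Finset.range m = D := by ext n; simp [hD]
    have h4 : G.card = m := by
      rw [hG, Finset.card_image_of_injective _ hπ.1, Finset.card_range]
    rw [Finset.card_range] at h1
    rw [Finset.inter_comm, h4, h3] at h2
    omega
  have hA := hcomp (Finset.range m \ G) D a hcard
    (fun n hn k hk => lt_of_lt_of_le (Finset.mem_range.1 (Finset.sdiff_subset hn))
      (Finset.mem_filter.1 hk).2)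
    (fun n hn k hk => by
      obtain ⟨i, hi, rfl⟩ := Finset.mem_image.1 (Finset.filter_subset _ _ hk)
      by_cases hn0 : B.coord n x = 0
      · simp [ha, hn0]
      · obtain ⟨j, rfl⟩ := hπ.2.1 hn0
        refine hπ.2.2 i j ?_
        -- An index in the support that is missing from `G` occurs in `π` at a position at least
        -- `m`, hence after every element of `G`.
        by_contra hji
        refine (Finset.mem_sdiff.1 hn).2 (Finset.mem_image_of_mem _ ?_)
        have := Finset.mem_range.1 hi
        exact Finset.mem_range.2 (by omega))
  have e : x - B.greedySum π m x =
      (y - B.indicatorSum a D) + B.indicatorSum a (Finset.range m \ G) := by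
    have h1 := B.indicatorSum_sdiff_add (Finset.filter_subset _ _ : D ⊆ G) a
    have h2 := B.indicatorSum_sdiff_add (Finset.inter_subset_right : G ∩ Finset.range m ⊆ _) a
    have h3 : Finset.range m \ (G ∩ Finset.range m) = Finset.range m \ G := by
      ext n; simp
    rw [h3] at h2
    rw [hGm] at h1
    rw [greedySum_eq B hπ.1, hy, partialSum_eq, ← h2, ← h1]
    abel
  rw [e, mul_assoc, add_mul]
  refine (N.add_le_modulus _ _).trans (mul_le_mul_of_nonneg_left (add_le_add hyD ?_) hκ.le)
  rw [mul_assoc]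
  exact hA.trans (mul_le_mul_of_nonneg_left hDy hK)

end MBasis
end GreedyApprox

/-! ### Doubling weights with positive lower dilation index -/

namespace GreedyApprox

namespace IsDoublingWeight

variable {ω : ℕ → ℝ}

lemma pos (hω : IsDoublingWeight ω) {n : ℕ} (hn : 1 ≤ n) : 0 < ω n :=
  hω.1.trans_le (hω.2.1 1 n le_rfl hn)

lemma exists_dilation (hω : IsDoublingWeight ω) (hi : 0 < lowerDilationIndex ω) :
    ∃ (M : ℕ) (φ : ℝ), 1 < M ∧ 1 < φ ∧ ∀ k, 1 ≤ k → φ * ω k ≤ ω (M * k) := by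
  obtain ⟨M, hM⟩ := lt_iSup_iff.1 hi
  obtain ⟨hM1, hM⟩ := lt_iSup_iff.1 hM
  have hnn : ∀ k : {k : ℕ // 1 ≤ k}, 0 ≤ ω (M * k) / ω k := fun k =>
    div_nonneg (hω.pos (by nlinarith [k.2])).le (hω.pos k.2).le
  -- Needed because `Real.log` is also positive at reals less than `-1`.
  have hφ0 : 0 ≤ lowerDilation ω M := Real.iInf_nonneg hnn
  have hlogM : 0 < Real.log M := Real.log_pos (by exact_mod_cast hM1)
  have hM' : 0 < Real.log (lowerDilation ω M) / Real.log M := by exact_mod_cast hM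
  have hlog : 0 < Real.log (lowerDilation ω M) := by
    by_contra h
    exact absurd hM' (not_lt.2 (div_nonpos_of_nonpos_of_nonneg (not_lt.1 h) hlogM.le))
  refine ⟨M, lowerDilation ω M, hM1, ?_, fun k hk => ?_⟩
  · by_contra h
    exact absurd hlog (not_lt.2 (Real.log_nonpos hφ0 (not_lt.1 h)))
  · rw [← le_div_iff₀ (hω.pos hk)]
    exact ciInf_le (f := fun k : {k : ℕ // 1 ≤ k} => ω (M * k) / ω k)
      ⟨0, by rintro _ ⟨k, rfl⟩; exact hnn k⟩ ⟨k, hk⟩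

lemma exists_two_pow_mul_ge (hω : IsDoublingWeight ω) (hi : 0 < lowerDilationIndex ω) (R : ℝ) :
    ∃ l : ℕ, ∀ u, 1 ≤ u → R * ω u ≤ ω (2 ^ l * u) := by
  obtain ⟨M, φ, hM, hφ, h⟩ := hω.exists_dilation hi
  have key : ∀ j u : ℕ, 1 ≤ u → φ ^ j * ω u ≤ ω (M ^ j * u) := by
    intro j u hu
    induction j with
    | zero => simp
    | succ j ih =>
      have h1 := h (M ^ j * u) (Nat.mul_pos (pow_pos (by omega) _) hu)
      have h2 : M ^ (j + 1) * u = M * (M ^ j * u) := by ring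
      rw [h2]
      refine le_trans ?_ h1
      rw [pow_succ, mul_comm (φ ^ j), mul_assoc]
      exact mul_le_mul_of_nonneg_left ih (by linarith)
  obtain ⟨j, hj⟩ := pow_unbounded_of_one_lt R hφ
  refine ⟨M ^ j, fun u hu => ?_⟩
  calc R * ω u ≤ φ ^ j * ω u := mul_le_mul_of_nonneg_right hj.le (hω.pos hu).le
    _ ≤ ω (M ^ j * u) := key j u hu
    _ ≤ _ := hω.2.1 _ _ (Nat.mul_pos (pow_pos (by omega) _) hu)
      (Nat.mul_le_mul_right _ Nat.lt_two_pow_self.le)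

lemma exists_mul_le (hω : IsDoublingWeight ω) {R : ℕ} (hR : 1 ≤ R) :
    ∃ Θ : ℝ, 0 < Θ ∧ ∀ u, 1 ≤ u → ω (R * u) ≤ Θ * ω u := by
  obtain ⟨h1, hmono, -, θ, hθ, hd⟩ := id hω
  have key : ∀ j u : ℕ, 1 ≤ u → ω (2 ^ j * u) ≤ θ ^ j * ω u := by
    intro j u hu
    induction j with
    | zero => simp
    | succ j ih =>
      have h2 := hd (2 ^ j * u) (Nat.mul_pos (by positivity) hu)
      rw [← mul_assoc, ← pow_succ'] at h2
      refine h2.trans ?_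
      rw [pow_succ', mul_assoc]
      exact mul_le_mul_of_nonneg_left ih (by linarith)
  refine ⟨θ ^ R, by positivity, fun u hu => ?_⟩
  exact (hmono _ _ (Nat.mul_pos hR hu) (Nat.mul_le_mul_right _ Nat.lt_two_pow_self.le)).trans
    (key R u hu)

/-- Split the sum at `u / M`. The upper block costs at most `M ω(u)^r`, while for the lower one
induction gains the factor `φ^{-r} < 1`. The constant `D` is the fixed point of `D ↦ D φ^{-r} + M`.
-/
lemma exists_sum_rpow_le (hω : IsDoublingWeight ω) (hi : 0 < lowerDilationIndex ω) {r : ℝ}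
    (hr : 0 < r) :
    ∃ D : ℝ, 0 < D ∧ ∀ u, 1 ≤ u →
      ∑ n ∈ Finset.range u, ω (n + 1) ^ r / ((n + 1 : ℕ) : ℝ) ≤ D * ω u ^ r := by
  obtain ⟨M, φ, hM, hφ, h⟩ := hω.exists_dilation hi
  have hφr : 1 < φ ^ r := Real.one_lt_rpow hφ hr
  have hden : 0 < 1 - (φ ^ r)⁻¹ := sub_pos.2 (inv_lt_one_of_one_lt₀ hφr)
  have hM0 : (0 : ℝ) < M := by exact_mod_cast (by omega : 0 < M)
  set D : ℝ := M / (1 - (φ ^ r)⁻¹) with hD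
  have hDeq : D * (φ ^ r)⁻¹ + M = D := by
    have : D * (1 - (φ ^ r)⁻¹) = M := div_mul_cancel₀ _ hden.ne'
    linarith
  have hD0 : 0 < D := by positivity
  refine ⟨D, hD0, fun u => ?_⟩
  have hblock : ∀ v u : ℕ, 1 ≤ u → v ≤ u → u < M * (v + 1) →
      ∑ n ∈ Finset.Ico v u, ω (n + 1) ^ r / ((n + 1 : ℕ) : ℝ) ≤ M * ω u ^ r := by
    intro v u hu hvu huM
    have h1 : ∀ n ∈ Finset.Ico v u, ω (n + 1) ^ r / ((n + 1 : ℕ) : ℝ) ≤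
        ω u ^ r / ((v + 1 : ℕ) : ℝ) := fun n hn => by
      obtain ⟨hvn, hnu⟩ := Finset.mem_Ico.1 hn
      have hp := (hω.pos (show 1 ≤ n + 1 by omega)).le
      refine div_le_div₀ (Real.rpow_nonneg (hω.pos (by omega)).le _)
        (Real.rpow_le_rpow hp (hω.2.1 _ _ (by omega) hnu) hr.le) (by positivity) ?_
      exact_mod_cast (by omega : v + 1 ≤ n + 1)
    refine (Finset.sum_le_card_nsmul _ _ _ h1).trans ?_
    have hp : 0 ≤ ω u ^ r := Real.rpow_nonneg (hω.pos hu).le _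
    rw [Nat.card_Ico, nsmul_eq_mul, mul_div_left_comm, mul_comm]
    refine mul_le_mul_of_nonneg_right ?_ hp
    rw [div_le_iff₀ (by positivity)]
    exact_mod_cast (by omega : u - v ≤ M * (v + 1))
  induction u using Nat.strong_induction_on with
  | _ u ih =>
    intro hu
    have hp : 0 ≤ ω u ^ r := Real.rpow_nonneg (hω.pos hu).le _
    have hlt : u < M * (u / M + 1) := by
      have := Nat.lt_div_mul_add (a := u) (b := M) (by omega)
      nlinarith
    have hb := hblock (u / M) u hu (Nat.div_le_self _ _) hlt
    rw [← Finset.sum_range_add_sum_Ico _ (Nat.div_le_self u M), ← hDeq, add_mul]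
    refine add_le_add ?_ hb
    rcases Nat.eq_zero_or_pos (u / M) with h0 | hv
    · rw [h0, Finset.sum_range_zero]; positivity
    · refine (ih _ (Nat.div_lt_self hu hM) hv).trans ?_
      rw [mul_assoc]
      refine mul_le_mul_of_nonneg_left ?_ hD0.le
      rw [← Real.inv_rpow (by linarith), ← Real.mul_rpow (by positivity) (hω.pos hu).le]
      refine Real.rpow_le_rpow (hω.pos hv).le ?_ hr.le
      rw [le_inv_mul_iff₀ (by linarith)]
      exact (h _ hv).trans (hω.2.1 _ _ (Nat.mul_pos (by omega) hv) (Nat.mul_div_le u M))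

end IsDoublingWeight

/-! ### Class norms of two-step error sequences -/

namespace MBasis

variable {𝕜 X : Type*} [RCLike 𝕜] [AddCommGroup X] [Module 𝕜 X] {N : QuasiNorm 𝕜 X}

/-- For errors that are at most `a` up to `u`, at most `b` up to `U` and then zero, each step costs
only its height times the weight at its right end, because the weighted sums are dominated by their
last term. -/
lemma exists_classNorm_le {ω : ℕ → ℝ} (hω : IsDoublingWeight ω) (hi : 0 < lowerDilationIndex ω)
    {q : ℝ≥0∞} (hq : 0 < q) (N : QuasiNorm 𝕜 X) :
    ∃ D : ℝ, 0 < D ∧ ∀ (E : ℕ → X → ℝ≥0∞) (x : X) (u U : ℕ) (a b : ℝ), 1 ≤ u → u ≤ U →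
      0 ≤ a → 0 ≤ b → N x ≤ a → (∀ n, 1 ≤ n → n ≤ u → E n x ≤ ENNReal.ofReal a) →
      (∀ n, u < n → n ≤ U → E n x ≤ ENNReal.ofReal b) → (∀ n, U < n → E n x = 0) →
        classNorm N E ω q x ≤ ENNReal.ofReal (D * (ω u * a + ω U * b)) := by
  suffices h : ∃ D : ℝ, 0 < D ∧ ∀ (E : ℕ → X → ℝ≥0∞) (x : X) (u U : ℕ) (a b : ℝ), 1 ≤ u →
      u ≤ U → 0 ≤ a → 0 ≤ b → (∀ n, 1 ≤ n → n ≤ u → E n x ≤ ENNReal.ofReal a) →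
      (∀ n, u < n → n ≤ U → E n x ≤ ENNReal.ofReal b) → (∀ n, U < n → E n x = 0) →
        (if q = ⊤ then ⨆ n : ℕ, ENNReal.ofReal (ω (n + 1)) * E (n + 1) x
        else (∑' n : ℕ, (ENNReal.ofReal (ω (n + 1)) * E (n + 1) x) ^ q.toReal
          / ((n + 1 : ℕ) : ℝ≥0∞)) ^ (1 / q.toReal)) ≤
          ENNReal.ofReal (D * (ω u * a + ω U * b)) by
    obtain ⟨D, hD, h⟩ := h
    have hω1 := hω.1
    refine ⟨1 / ω 1 + D, by positivity, fun E x u U a b hu huU ha hb hN h1 h2 h3 => ?_⟩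
    have hωU := (hω.pos (hu.trans huU)).le
    have hωu := (hω.pos hu).le
    rw [add_mul, ENNReal.ofReal_add (by positivity) (by positivity), classNorm]
    refine add_le_add (ENNReal.ofReal_le_ofReal (hN.trans ?_)) ?_
    · rw [one_div, le_inv_mul_iff₀ hω1]
      have := mul_le_mul_of_nonneg_right (hω.2.1 1 u le_rfl hu) ha
      have := mul_nonneg hωU hb
      linarith
    · convert h E x u U a b hu huU ha hb h1 h2 h3
  have hterm : ∀ (n u : ℕ) (s : ℝ) (e : ℝ≥0∞), n < u → 0 ≤ s → e ≤ ENNReal.ofReal s →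
      ENNReal.ofReal (ω (n + 1)) * e ≤ ENNReal.ofReal (ω (n + 1) * s) := by
    intro n u s e hn hs he
    rw [ENNReal.ofReal_mul (hω.pos (by omega)).le]
    exact mul_le_mul_right he _
  split_ifs with hqt
  · refine ⟨1, one_pos, fun E x u U a b hu huU ha hb h1 h2 h3 => iSup_le fun n => ?_⟩
    have hωU := (hω.pos (hu.trans huU)).le
    have hωu := (hω.pos hu).le
    rw [one_mul]
    rcases lt_or_ge n u with hn | hn
    · refine (hterm n u a _ hn ha (h1 _ (by omega) hn)).trans (ENNReal.ofReal_le_ofReal ?_)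
      have := mul_le_mul_of_nonneg_right (hω.2.1 (n + 1) u (by omega) hn) ha
      have := mul_nonneg hωU hb
      linarith
    rcases lt_or_ge n U with hn' | hn'
    · refine (hterm n U b _ hn' hb (h2 _ (by omega) hn')).trans (ENNReal.ofReal_le_ofReal ?_)
      have := mul_le_mul_of_nonneg_right (hω.2.1 (n + 1) U (by omega) hn') hb
      have := mul_nonneg hωu ha
      linarith
    · rw [h3 _ (by omega), mul_zero]; exact zero_le
  · set r := q.toReal with hrdef
    have hr : 0 < r := ENNReal.toReal_pos hq.ne' hqt
    obtain ⟨D, hD, hsum⟩ := hω.exists_sum_rpow_le hi hr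
    refine ⟨(2 * D) ^ (1 / r), by positivity, fun E x u U a b hu huU ha hb h1 h2 h3 => ?_⟩
    have hωU := (hω.pos (hu.trans huU)).le
    have hωu := (hω.pos hu).le
    have hterm' : ∀ (n u : ℕ) (s : ℝ) (e : ℝ≥0∞), n < u → 0 ≤ s → e ≤ ENNReal.ofReal s →
        (ENNReal.ofReal (ω (n + 1)) * e) ^ r / ((n + 1 : ℕ) : ℝ≥0∞) ≤
          ENNReal.ofReal (s ^ r * (ω (n + 1) ^ r / ((n + 1 : ℕ) : ℝ))) := by
      intro n u s e hn hs he
      have hp := (hω.pos (show 1 ≤ n + 1 by omega)).le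
      rw [← mul_div_assoc, ENNReal.ofReal_div_of_pos (by positivity), ENNReal.ofReal_natCast,
        mul_comm (s ^ r), ← Real.mul_rpow hp hs, ← ENNReal.ofReal_rpow_of_nonneg (by positivity) hr.le]
      exact ENNReal.div_le_div_right
        (ENNReal.rpow_le_rpow (hterm n u s e hn hs he) hr.le) _
    have hsum' : ∀ (v u : ℕ) (s : ℝ), v ≤ u → 1 ≤ u → 0 ≤ s →
        (∀ n, v < n → n ≤ u → E n x ≤ ENNReal.ofReal s) →
        ∑ n ∈ Finset.Ico v u, (ENNReal.ofReal (ω (n + 1)) * E (n + 1) x) ^ r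
          / ((n + 1 : ℕ) : ℝ≥0∞) ≤ ENNReal.ofReal (D * (ω u * s) ^ r) := by
      intro v u s hvu hu hs hE
      have hnn : ∀ n, 0 ≤ s ^ r * (ω (n + 1) ^ r / ((n + 1 : ℕ) : ℝ)) := fun n =>
        mul_nonneg (by positivity) (div_nonneg (Real.rpow_nonneg (hω.pos (by omega)).le _)
          (by positivity))
      calc _ ≤ ∑ n ∈ Finset.Ico v u,
            ENNReal.ofReal (s ^ r * (ω (n + 1) ^ r / ((n + 1 : ℕ) : ℝ))) :=
            Finset.sum_le_sum fun n hn => by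
              obtain ⟨hn1, hn2⟩ := Finset.mem_Ico.1 hn
              exact hterm' n u s _ hn2 hs (hE _ (by omega) hn2)
        _ ≤ ∑ n ∈ Finset.range u,
            ENNReal.ofReal (s ^ r * (ω (n + 1) ^ r / ((n + 1 : ℕ) : ℝ))) :=
            Finset.sum_le_sum_of_subset fun n hn =>
              Finset.mem_range.2 (Finset.mem_Ico.1 hn).2
        _ = ENNReal.ofReal (s ^ r * ∑ n ∈ Finset.range u,
              ω (n + 1) ^ r / ((n + 1 : ℕ) : ℝ)) := by
            rw [Finset.mul_sum, ENNReal.ofReal_sum_of_nonneg fun n _ => hnn n]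
        _ ≤ _ := by
            refine ENNReal.ofReal_le_ofReal ?_
            rw [Real.mul_rpow (hω.pos hu).le hs]
            have := mul_le_mul_of_nonneg_left (hsum u hu) (Real.rpow_nonneg hs r)
            linarith
    have htsum : ∑' n : ℕ, (ENNReal.ofReal (ω (n + 1)) * E (n + 1) x) ^ r
        / ((n + 1 : ℕ) : ℝ≥0∞) ≤ ENNReal.ofReal (2 * D * (ω u * a + ω U * b) ^ r) := by
      rw [tsum_eq_sum (s := Finset.range U) fun n hn => by
        rw [h3 _ (by simpa [Nat.lt_succ_iff] using hn), mul_zero, ENNReal.zero_rpow_of_pos hr,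
          ENNReal.zero_div],
        ← Finset.sum_range_add_sum_Ico _ huU, Finset.range_eq_Ico]
      refine (add_le_add (hsum' 0 u a (Nat.zero_le _) hu ha fun n hn hn' => h1 n hn hn')
        (hsum' u U b huU (hu.trans huU) hb h2)).trans ?_
      rw [← ENNReal.ofReal_add (by positivity) (by positivity)]
      refine ENNReal.ofReal_le_ofReal ?_
      have e1 : (ω u * a) ^ r ≤ (ω u * a + ω U * b) ^ r :=
        Real.rpow_le_rpow (by positivity) (by linarith [mul_nonneg hωU hb]) hr.le
      have e2 : (ω U * b) ^ r ≤ (ω u * a + ω U * b) ^ r :=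
        Real.rpow_le_rpow (by positivity) (by linarith [mul_nonneg hωu ha]) hr.le
      nlinarith
    refine (ENNReal.rpow_le_rpow htsum (by positivity)).trans ?_
    rw [ENNReal.ofReal_rpow_of_nonneg (by positivity) (by positivity),
      Real.mul_rpow (by positivity) (by positivity), ← Real.rpow_mul (by positivity),
      mul_one_div_cancel hr.ne', Real.rpow_one]

/-- The block of indices from `v + 1` to `2 * v` is enough: `v` terms, each carrying a factor `1 / n
≥ 1 / (2 * v)` and a weight at least `ω v`. -/
lemma exists_le_classNorm {ω : ℕ → ℝ} (hω : IsDoublingWeight ω) {q : ℝ≥0∞} (hq : 0 < q)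
    (N : QuasiNorm 𝕜 X) :
    ∃ c : ℝ, 0 < c ∧ ∀ (E : ℕ → X → ℝ≥0∞) (x : X) (v : ℕ) (s : ℝ), 1 ≤ v → 0 ≤ s →
      (∀ n, 1 ≤ n → n ≤ 2 * v → ENNReal.ofReal s ≤ E n x) →
        ENNReal.ofReal (c * (ω v * s)) ≤ classNorm N E ω q x := by
  simp only [classNorm]
  split_ifs with hqt
  · refine ⟨1, one_pos, fun E x v s hv hs h => le_add_left ?_⟩
    obtain ⟨n, rfl⟩ : ∃ n, v = n + 1 := ⟨v - 1, by omega⟩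
    rw [one_mul, ENNReal.ofReal_mul (hω.pos hv).le]
    exact (mul_le_mul_right (h _ hv (by omega)) _).trans
      (le_iSup (fun n : ℕ => ENNReal.ofReal (ω (n + 1)) * E (n + 1) x) n)
  · set r := q.toReal with hrdef
    have hr : 0 < r := ENNReal.toReal_pos hq.ne' hqt
    refine ⟨(1 / 2) ^ (1 / r), by positivity, fun E x v s hv hs h => le_add_left ?_⟩
    have hωv := (hω.pos hv).le
    have h0 : 0 ≤ (ω v * s) ^ r := by positivity
    have e : (1 / 2 : ℝ) ^ (1 / r) * (ω v * s) = (1 / 2 * (ω v * s) ^ r) ^ (1 / r) := by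
      rw [Real.mul_rpow (by positivity) h0, ← Real.rpow_mul (by positivity),
        mul_one_div_cancel hr.ne', Real.rpow_one]
    rw [e, ← ENNReal.ofReal_rpow_of_nonneg (by positivity) (by positivity)]
    refine ENNReal.rpow_le_rpow ?_ (by positivity)
    refine le_trans ?_ (ENNReal.sum_le_tsum (Finset.Ico v (2 * v)))
    have hterm : ∀ n ∈ Finset.Ico v (2 * v),
        ENNReal.ofReal ((ω v * s) ^ r / ((2 * v : ℕ) : ℝ)) ≤
          (ENNReal.ofReal (ω (n + 1)) * E (n + 1) x) ^ r / ((n + 1 : ℕ) : ℝ≥0∞) := by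
      intro n hn
      obtain ⟨hn1, hn2⟩ := Finset.mem_Ico.1 hn
      rw [ENNReal.ofReal_div_of_pos (by exact_mod_cast (by omega : 0 < 2 * v)),
        ENNReal.ofReal_natCast, ← ENNReal.ofReal_rpow_of_nonneg (by positivity) hr.le,
        ENNReal.ofReal_mul hωv]
      refine ENNReal.div_le_div (ENNReal.rpow_le_rpow (mul_le_mul' (ENNReal.ofReal_le_ofReal
        (hω.2.1 _ _ hv (by omega))) (h _ (by omega) hn2)) hr.le) ?_
      exact_mod_cast hn2
    refine le_trans ?_ (Finset.card_nsmul_le_sum _ _ _ hterm)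
    rw [Nat.card_Ico, nsmul_eq_mul, ← ENNReal.ofReal_natCast, ← ENNReal.ofReal_mul (by positivity)]
    refine ENNReal.ofReal_le_ofReal (le_of_eq ?_)
    have hv0 : (v : ℝ) ≠ 0 := by exact_mod_cast (by omega : v ≠ 0)
    have : 2 * v - v = v := by omega
    rw [this]
    push_cast
    field_simp

end MBasis
end GreedyApprox

/-! ### From the embedding to super-conservativity -/

namespace GreedyApprox
namespace MBasis

variable {𝕜 X : Type*} [RCLike 𝕜] [AddCommGroup X] [Module 𝕜 X] {N : QuasiNorm 𝕜 X}
  {B : MBasis N}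

lemma hl_le_hRr (B : MBasis N) (m u : ℕ) : B.hl m ≤ B.hRr m u :=
  le_iInf fun A => le_iInf fun ε => le_iInf fun h =>
    iInf_le_of_le A (iInf_le_of_le ε (iInf_le_of_le ⟨h.1.ge, h.2.2⟩ le_rfl))

lemma hRr_le (B : MBasis N) {A : Finset ℕ} {ε : ℕ → 𝕜} {m u : ℕ} (hA : A.card = m)
    (hu : ∀ n ∈ A, u ≤ n) (hε : ∀ n ∈ A, ‖ε n‖ = 1) :
    B.hRr m u ≤ ENNReal.ofReal (N (B.indicatorSum ε A)) :=
  iInf_le_of_le A (iInf_le_of_le ε (iInf_le_of_le ⟨hA, hu, hε⟩ le_rfl))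

lemma le_hRl (B : MBasis N) {A : Finset ℕ} {ε : ℕ → 𝕜} {m u : ℕ} (hA : A.card = m)
    (hu : ∀ n ∈ A, n < u) (hε : ∀ n ∈ A, ‖ε n‖ = 1) :
    ENNReal.ofReal (N (B.indicatorSum ε A)) ≤ B.hRl m u :=
  le_iSup_of_le A (le_iSup_of_le ε (le_iSup_of_le ⟨hA, hu, hε⟩ le_rfl))

lemma hRr_anti (B : MBasis N) (m : ℕ) {u v : ℕ} (huv : u ≤ v) : B.hRr m u ≤ B.hRr m v :=
  le_iInf fun _ => le_iInf fun _ => le_iInf fun h =>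
    B.hRr_le h.1 (fun n hn => huv.trans (h.2.1 n hn)) h.2.2

lemma PropertyI.exists_hRr_two_pow_mul_le (hI : B.PropertyI) (l : ℕ) :
    ∃ K : ℝ, 0 < K ∧ ∀ u, 1 ≤ u → B.hRr (2 ^ l * u) u ≤ ENNReal.ofReal K * B.hRr u u := by
  obtain ⟨hsup, -⟩ := hI
  set S : ℝ≥0∞ := ⨆ (l : ℕ) (u : ℕ) (_ : 1 ≤ u), B.hRr (2 ^ (l + 1) * u) u / B.hRr (2 ^ l * u) u
    with hS
  -- Working with `S + 1` gives a finite nonzero factor, so the quotients can be cleared without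
  -- knowing that the denominators are nonzero and finite.
  have hS1 : S + 1 ≠ ⊤ := ENNReal.add_ne_top.2 ⟨hsup.ne, ENNReal.one_ne_top⟩
  have hstep : ∀ l u, 1 ≤ u → B.hRr (2 ^ (l + 1) * u) u ≤ (S + 1) * B.hRr (2 ^ l * u) u := by
    intro l u hu
    refine (ENNReal.div_le_iff_le_mul (Or.inr hS1) (Or.inr (by simp))).1 ?_
    exact (le_iSup_of_le l (le_iSup₂ (f := fun (u : ℕ) (_ : 1 ≤ u) =>
      B.hRr (2 ^ (l + 1) * u) u / B.hRr (2 ^ l * u) u) u hu)).trans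
      (le_add_right (le_refl S))
  have key : ∀ l u, 1 ≤ u → B.hRr (2 ^ l * u) u ≤ (S + 1) ^ l * B.hRr u u := by
    intro l u hu
    induction l with
    | zero => simp
    | succ l ih =>
      refine (hstep l u hu).trans ?_
      rw [pow_succ', mul_assoc]
      exact mul_le_mul_right ih _
  refine ⟨((S + 1) ^ l).toReal, ENNReal.toReal_pos (by simp) (ENNReal.pow_ne_top hS1),
    fun u hu => ?_⟩
  rw [ENNReal.ofReal_toReal (ENNReal.pow_ne_top hS1)]
  exact key l u hu

lemma IsSchauder.exists_tail_le (hS : B.IsSchauder) :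
    ∃ C : ℝ, 1 ≤ C ∧ ∀ (m : ℕ) (x : X), 1 ≤ m → N (x - B.partialSum m x) ≤ C * N x := by
  obtain ⟨C, hC, h⟩ := hS
  have hκ := N.one_le_modulus
  refine ⟨N.modulus * (1 + C), by nlinarith, fun m x hm => ?_⟩
  rw [mul_assoc]
  refine (N.sub_le_modulus _ _).trans (mul_le_mul_of_nonneg_left ?_ N.modulus_pos.le)
  linarith [h m hm x]

lemma partialSum_indicatorSum (B : MBasis N) (a : ℕ → 𝕜) (A : Finset ℕ) (m : ℕ) :
    B.partialSum m (B.indicatorSum a A) = B.indicatorSum a (A.filter (· < m)) := by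
  have h : A.filter (· < m) = (Finset.range m).filter (· ∈ A) := by
    ext n; simp [and_comm]
  simp only [partialSum, coord_indicatorSum]
  rw [h, indicatorSum, Finset.sum_filter]
  refine Finset.sum_congr rfl fun n _ => ?_
  split_ifs <;> simp

lemma sub_partialSum_indicatorSum (B : MBasis N) (a : ℕ → 𝕜) (A : Finset ℕ) (m : ℕ) :
    B.indicatorSum a A - B.partialSum m (B.indicatorSum a A) =
      B.indicatorSum a (A.filter (m ≤ ·)) := by
  have h : A \ A.filter (· < m) = A.filter (m ≤ ·) := by
    ext n; simp; tauto
  rw [partialSum_indicatorSum, sub_eq_iff_eq_add, ← h,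
    indicatorSum_sdiff_add B (Finset.filter_subset _ _)]

/-- Test vectors `1_{ε[1,u]} + 1_{εD}` with `D` to the right of `u`, for the embedding of the
classes. The constant does not depend on the size of `D`. -/
lemma exists_embedding_test {ω : ℕ → ℝ} (hω : IsDoublingWeight ω) (hi : 0 < lowerDilationIndex ω)
    {C : ℝ} (hC : 1 ≤ C) (h : B.GreedyProjBound C) (hS : B.IsSchauder) {q : ℝ≥0∞} (hq : 0 < q)
    (hemb : ContEmbeds (B.partiallyGreedyNorm ω q) (B.greedyNorm ω q)) :
    ∃ K : ℝ, 0 < K ∧ ∀ (u U v : ℕ) (ε : ℕ → 𝕜) (D : Finset ℕ), 1 ≤ u → u ≤ U → 1 ≤ v →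
      (∀ n, ‖ε n‖ = 1) → (∀ n ∈ D, u ≤ n ∧ n < U) → 2 * v ≤ D.card →
        ω v * N (B.indicatorSum ε (Finset.range u)) ≤
          K * (ω u * N (B.indicatorSum ε (Finset.range u)) + ω U * N (B.indicatorSum ε D)) := by
  obtain ⟨-, Ce, hCe, hemb⟩ := hemb
  obtain ⟨Ct, hCt, htail⟩ := hS.exists_tail_le
  obtain ⟨D₀, hD₀, hupper⟩ := exists_classNorm_le (X := X) hω hi hq N
  obtain ⟨c, hc, hlower⟩ := exists_le_classNorm hω hq N
  have hκ := N.one_le_modulus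
  refine ⟨C / c * (Ce * (D₀ * (2 * (Ct * N.modulus)))), by positivity,
    fun u U v ε D hu huU hv hε hD hDv => ?_⟩
  set P := N (B.indicatorSum ε (Finset.range u)) with hP
  set R := N (B.indicatorSum ε D) with hR
  have hP0 : 0 ≤ P := N.nonneg _
  have hR0 : 0 ≤ R := N.nonneg _
  have hωu := (hω.pos hu).le
  have hωU := (hω.pos (hu.trans huU)).le
  have hωuU := hω.2.1 u U hu huU
  have hdisj : Disjoint (Finset.range u) D := Finset.disjoint_left.2 fun n hn hn' => by
    have := (hD n hn').1
    have := Finset.mem_range.1 hn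
    omega
  set A := Finset.range u ∪ D with hA
  set x := B.indicatorSum ε A with hx
  have hxN : N x ≤ N.modulus * (P + R) := by
    rw [hx, hA, indicatorSum_union B hdisj]; exact N.add_le_modulus _ _
  have hpg : B.partiallyGreedyNorm ω q x ≤
      ENNReal.ofReal (D₀ * (ω u * (Ct * (N.modulus * (P + R))) + ω U * (Ct * R))) := by
    refine hupper B.beta x u U _ _ hu huU (by positivity) (by positivity) ?_ ?_ ?_ ?_
    · exact hxN.trans (le_mul_of_one_le_left (by positivity) hCt)
    · intro n hn _
      exact ENNReal.ofReal_le_ofReal ((htail n x hn).trans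
        (mul_le_mul_of_nonneg_left hxN (by linarith)))
    · intro n hn _
      refine ENNReal.ofReal_le_ofReal (le_trans (le_of_eq ?_)
        (htail n (B.indicatorSum ε D) (by omega)))
      -- Beyond `u`, the tails of `x` and of its part on `D` coincide.
      rw [hx, sub_partialSum_indicatorSum, sub_partialSum_indicatorSum]
      congr 2
      ext k
      simp only [hA, Finset.mem_filter, Finset.mem_union, Finset.mem_range]
      constructor
      · rintro ⟨hk | hk, hk'⟩
        · omega
        · exact ⟨hk, hk'⟩
      · rintro ⟨hk, hk'⟩
        exact ⟨Or.inr hk, hk'⟩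
    · intro n hn
      have : A.filter (n ≤ ·) = ∅ := Finset.filter_eq_empty_iff.2 fun k hk => by
        rcases Finset.mem_union.1 hk with hk | hk
        · have := Finset.mem_range.1 hk; omega
        · have := (hD k hk).2; omega
      rw [beta, hx, sub_partialSum_indicatorSum, this, indicatorSum_empty, N.map_zero,
        ENNReal.ofReal_zero]
  have hg : ENNReal.ofReal (c * (ω v * (P / C))) ≤ B.greedyNorm ω q x := by
    refine hlower B.gamma x v (P / C) hv (by positivity) fun n _ hn => ?_
    -- Since all coefficients of `x` have modulus one, any `G ⊆ D` of size `n` can be removed first.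
    -- What remains contains the whole initial segment, so its norm is at least `P / C`.
    obtain ⟨G, hGD, rfl⟩ := Finset.exists_subset_card_eq (hn.trans hDv)
    have hGA : G ⊆ A := hGD.trans Finset.subset_union_right
    refine le_trans (ENNReal.ofReal_le_ofReal ?_) (B.le_gamma ε hGA fun n _ k _ => by
      rw [hε, hε])
    rw [div_le_iff₀' (by linarith)]
    refine h.indicator_le (fun n hn => Finset.mem_sdiff.2
      ⟨Finset.subset_union_left hn, fun hn' => ?_⟩) fun n _ => hε n
    exact Finset.disjoint_left.1 hdisj hn (hGD hn')
  have hchain := hg.trans ((hemb x (hpg.trans_lt ENNReal.ofReal_lt_top)).trans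
    (mul_le_mul_right hpg _))
  rw [← ENNReal.ofReal_mul hCe.le, ENNReal.ofReal_le_ofReal_iff (by positivity)] at hchain
  have hbound : ω u * (Ct * (N.modulus * (P + R))) + ω U * (Ct * R) ≤
      2 * (Ct * N.modulus) * (ω u * P + ω U * R) := by
    have e1 : ω U * (Ct * R) ≤ Ct * N.modulus * (ω U * R) := by
      have : 0 ≤ Ct * (ω U * R) := by positivity
      nlinarith
    have e2 : Ct * N.modulus * (ω u * R) ≤ Ct * N.modulus * (ω U * R) := by gcongr
    have e3 : 0 ≤ Ct * N.modulus * (ω u * P) := by positivity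
    nlinarith
  have hfin : c * (ω v * (P / C)) ≤
      Ce * (D₀ * (2 * (Ct * N.modulus) * (ω u * P + ω U * R))) := hchain.trans (by gcongr)
  have hC0 : 0 < C := by linarith
  calc ω v * P = C / c * (c * (ω v * (P / C))) := by field_simp
    _ ≤ C / c * (Ce * (D₀ * (2 * (Ct * N.modulus) * (ω u * P + ω U * R)))) := by gcongr
    _ = _ := by ring

/-- The test inequality is applied with `v = 2 ^ l * u`, where `l` makes `ω v ≥ 2 K ω u` and the
initial segment is absorbed, and with `D` cut out of a nearly minimal set given by Property (W*). -/
lemma exists_initial_le_hRr {ω : ℕ → ℝ} (hω : IsDoublingWeight ω)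
    (hi : 0 < lowerDilationIndex ω) {C : ℝ} (hC : 1 ≤ C) (h : B.GreedyProjBound C)
    (hS : B.IsSchauder) (hI : B.PropertyI) (hW : B.PropertyWStar) {q : ℝ≥0∞} (hq : 0 < q)
    (hemb : ContEmbeds (B.partiallyGreedyNorm ω q) (B.greedyNorm ω q)) :
    ∃ K : ℝ, 0 < K ∧ ∀ (u : ℕ) (ε : ℕ → 𝕜), 1 ≤ u → (∀ n ∈ Finset.range u, ‖ε n‖ = 1) →
      ENNReal.ofReal (N (B.indicatorSum ε (Finset.range u))) ≤
        ENNReal.ofReal K * B.hRr u u := by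
  obtain ⟨K, hK, htest⟩ := exists_embedding_test hω hi hC h hS hq hemb
  obtain ⟨l, hl⟩ := hω.exists_two_pow_mul_ge hi (2 * K)
  obtain ⟨C₁, C₂, hC₁, hC₂, hW⟩ := hW
  obtain ⟨L, hL, hIl⟩ := hI.exists_hRr_two_pow_mul_le (l + 2)
  set T : ℕ := (⌈C₁⌉₊ + 1) * 2 ^ (l + 2) with hT
  have hT1 : 1 ≤ T := Nat.mul_pos (by omega) (by positivity)
  obtain ⟨Θ, hΘ, hdoub⟩ := hω.exists_mul_le hT1
  refine ⟨2 * Θ * C * C₂ * L, by positivity, fun u ε hu hε => ?_⟩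
  have hm : 1 ≤ 2 ^ (l + 2) * u := Nat.mul_pos (by positivity) hu
  -- The size is `4 * v`: after removing at most `u ≤ v` indices, at least `2 * v` remain, as the
  -- test requires.
  obtain ⟨A, δ, hcard, hAC, hδ, hAl⟩ := hW (2 ^ (l + 2) * u) hm
  set D := A \ Finset.range u with hD
  -- The test uses one sign sequence, unimodular on all of `ℕ`: `ε` on the initial segment, `δ` on
  -- `D`, and `1` elsewhere.
  let η : ℕ → 𝕜 := fun n => if n < u then ε n else if n ∈ A then δ n else 1
  have hη : ∀ n, ‖η n‖ = 1 := fun n => by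
    simp only [η]
    split_ifs with h1 h2
    · exact hε n (Finset.mem_range.2 h1)
    · exact hδ n h2
    · simp
  have hηu : B.indicatorSum η (Finset.range u) = B.indicatorSum ε (Finset.range u) :=
    B.indicatorSum_congr fun n hn => if_pos (Finset.mem_range.1 hn)
  have hηD : B.indicatorSum η D = B.indicatorSum δ D := B.indicatorSum_congr fun n hn => by
    obtain ⟨h1, h2⟩ := Finset.mem_sdiff.1 hn
    simp only [η, if_neg (fun h' => h2 (Finset.mem_range.2 h') : ¬ n < u), if_pos h1]
  have hDcard : 2 * (2 ^ l * u) ≤ D.card := by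
    have h1 := Finset.le_card_sdiff (Finset.range u) A
    rw [hcard, Finset.card_range] at h1
    have h2 : 1 ≤ 2 ^ l := Nat.one_le_two_pow
    have h3 : 2 ^ (l + 2) * u = 4 * (2 ^ l * u) := by ring
    have h4 : u ≤ 2 ^ l * u := Nat.le_mul_of_pos_left _ h2
    rw [h3] at h1
    exact le_trans (by omega) h1
  have hDU : ∀ n ∈ D, u ≤ n ∧ n < T * u := fun n hn => by
    obtain ⟨h1, h2⟩ := Finset.mem_sdiff.1 hn
    refine ⟨by simpa using h2, ?_⟩
    have h3 := hAC n h1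
    have h4 : C₁ ≤ (⌈C₁⌉₊ : ℝ) + 1 := (Nat.le_ceil C₁).trans (by linarith)
    have h5 : (n : ℝ) + 1 ≤ ((⌈C₁⌉₊ : ℝ) + 1) * ((2 ^ (l + 2) * u : ℕ) : ℝ) :=
      h3.trans (mul_le_mul_of_nonneg_right h4 (by positivity))
    have h6 : n + 1 ≤ (⌈C₁⌉₊ + 1) * (2 ^ (l + 2) * u) := by exact_mod_cast h5
    rw [hT, mul_assoc]
    omega
  have hmain := htest u (T * u) (2 ^ l * u) η D hu (Nat.le_mul_of_pos_left _ hT1)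
    (Nat.mul_pos (by positivity) hu) hη hDU hDcard
  rw [hηu, hηD] at hmain
  set P := N (B.indicatorSum ε (Finset.range u)) with hP
  set R := N (B.indicatorSum δ D) with hR
  have hP0 : 0 ≤ P := N.nonneg _
  have hR0 : 0 ≤ R := N.nonneg _
  have hωu := hω.pos hu
  have hPR : P ≤ 2 * Θ * R := by
    have h1 := mul_le_mul_of_nonneg_right (hl u hu) hP0
    have h2 : K * (ω (T * u) * R) ≤ K * (Θ * ω u * R) := by
      have := hdoub u hu
      gcongr
    have h3 : K * ω u * P ≤ K * ω u * (2 * Θ * R) := by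
      nlinarith [mul_nonneg (mul_nonneg hK.le hωu.le) (mul_nonneg hΘ.le hR0)]
    exact le_of_mul_le_mul_left h3 (by positivity)
  have hRA : R ≤ C * N (B.indicatorSum δ A) := h.indicator_le Finset.sdiff_subset hδ
  calc ENNReal.ofReal P ≤ ENNReal.ofReal (2 * Θ * C * N (B.indicatorSum δ A)) := by
        refine ENNReal.ofReal_le_ofReal (hPR.trans ?_)
        rw [mul_assoc (2 * Θ)]
        exact mul_le_mul_of_nonneg_left hRA (by positivity)
    _ = ENNReal.ofReal (2 * Θ * C) * ENNReal.ofReal (N (B.indicatorSum δ A)) :=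
        ENNReal.ofReal_mul (by positivity)
    _ ≤ ENNReal.ofReal (2 * Θ * C) * (ENNReal.ofReal C₂ * (ENNReal.ofReal L * B.hRr u u)) := by
        gcongr
        refine hAl.trans ?_
        gcongr
        exact (B.hl_le_hRr _ u).trans (hIl u hu)
    _ = _ := by
        rw [ENNReal.ofReal_mul (by positivity : 0 ≤ 2 * Θ * C * C₂),
          ENNReal.ofReal_mul (by positivity : 0 ≤ 2 * Θ * C)]
        ring

lemma isSuperConservative_of_contEmbeds {ω : ℕ → ℝ} (hω : IsDoublingWeight ω)
    (hi : 0 < lowerDilationIndex ω) (hB : B.IsQuasiGreedy)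
    (hS : B.IsSchauder) (hI : B.PropertyI) (hW : B.PropertyWStar) {q : ℝ≥0∞} (hq : 0 < q)
    (hemb : ContEmbeds (B.partiallyGreedyNorm ω q) (B.greedyNorm ω q)) :
    B.IsSuperConservative := by
  obtain ⟨C, hC, h⟩ := hB.exists_greedyProjBound
  obtain ⟨K, hK, hinit⟩ := exists_initial_le_hRr hω hi hC h hS hI hW hq hemb
  obtain ⟨-, ψ, ⟨hψ, Cψ, hCψ, hchar⟩, CI, hCI, hI⟩ := hI
  -- For `u ≤ ψ m`, enlarge the set to the whole initial segment of length `u`, compare with `hRr u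
  -- u`, and return to size `m` by Property (I)(ii).
  have hnear : ∀ m u, 1 ≤ m → m ≤ u → u ≤ ψ m →
      B.hRl m u ≤ ENNReal.ofReal (C * K * CI) * B.hRr m u := by
    intro m u hm hmu huψ
    refine iSup_le fun A => iSup_le fun ε => iSup_le fun ⟨hA, hAu, hε⟩ => ?_
    let η : ℕ → 𝕜 := fun n => if n ∈ A then ε n else 1
    have hη : ∀ n ∈ Finset.range u, ‖η n‖ = 1 := fun n _ => by
      simp only [η]
      split_ifs with hn
      · exact hε n hn
      · simp
    have e : B.indicatorSum ε A = B.indicatorSum η A :=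
      B.indicatorSum_congr fun n hn => (if_pos hn).symm
    have h1 := h.indicator_le (fun n hn => Finset.mem_range.2 (hAu n hn)) hη
    rw [e]
    calc _ ≤ ENNReal.ofReal (C * N (B.indicatorSum η (Finset.range u))) :=
          ENNReal.ofReal_le_ofReal h1
      _ = ENNReal.ofReal C * ENNReal.ofReal (N (B.indicatorSum η (Finset.range u))) :=
          ENNReal.ofReal_mul (by linarith)
      _ ≤ ENNReal.ofReal C * (ENNReal.ofReal K * (ENNReal.ofReal CI * B.hRr m u)) := by
          gcongr
          refine (hinit u η (hm.trans hmu) hη).trans ?_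
          gcongr
          exact hI m u hm (hm.trans hmu) huψ
      _ = _ := by
          rw [ENNReal.ofReal_mul (by positivity : 0 ≤ C * K),
            ENNReal.ofReal_mul (by positivity : 0 ≤ C)]
          ring
  have hall : ∀ m u, 1 ≤ m → m ≤ u →
      B.hRl m u ≤ ENNReal.ofReal ((Cψ + 1) * (C * K * CI)) * B.hRr m u := by
    intro m u hm hmu
    have hCKI : 0 ≤ C * K * CI := by positivity
    rcases le_total u (ψ m) with hu | hu
    · refine (hnear m u hm hmu hu).trans ?_
      exact mul_le_mul_left (ENNReal.ofReal_le_ofReal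
        (le_mul_of_one_le_left hCKI (by linarith))) _
    -- For `u ≥ ψ m`, the characteristic function moves the left-hand side down to `ψ m`, and `hRr
    -- m` is nondecreasing in its second argument.
    · calc B.hRl m u ≤ ⨆ (u : ℕ) (_ : m ≤ u), B.hRl m u :=
            le_iSup_of_le u (le_iSup_of_le hmu le_rfl)
        _ ≤ ENNReal.ofReal Cψ * (ENNReal.ofReal (C * K * CI) * B.hRr m (ψ m)) :=
            (hchar m hm).trans (mul_le_mul_right (hnear m _ hm (hψ m hm) le_rfl) _)
        _ ≤ ENNReal.ofReal (Cψ + 1) * (ENNReal.ofReal (C * K * CI) * B.hRr m u) := by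
            gcongr
            · linarith
            · exact B.hRr_anti m hu
        _ = _ := by rw [ENNReal.ofReal_mul (by positivity : 0 ≤ Cψ + 1)]; ring
  refine ⟨(Cψ + 1) * (C * K * CI), by positivity, fun A D ε δ hcard hAD hε hδ => ?_⟩
  rcases A.eq_empty_or_nonempty with rfl | hA
  · rw [indicatorSum_empty, N.map_zero]
    exact mul_nonneg (by positivity) (N.nonneg _)
  set u := A.max' hA + 1 with hu
  have hAu : ∀ n ∈ A, n < u := fun n hn => Nat.lt_succ_of_le (A.le_max' n hn)
  have hmu : A.card ≤ u := by
    simpa using Finset.card_le_card (fun n hn => Finset.mem_range.2 (hAu n hn) :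
      A ⊆ Finset.range u)
  have hchain := (B.le_hRl rfl hAu hε).trans ((hall _ u hA.card_pos hmu).trans
    (mul_le_mul_right (B.hRr_le hcard.symm
      (fun k hk => hAD _ (A.max'_mem hA) k hk) hδ) _))
  rw [← ENNReal.ofReal_mul (by positivity)] at hchain
  exact (ENNReal.ofReal_le_ofReal_iff (mul_nonneg (by positivity) (N.nonneg _))).1 hchain

/-! ### Partial greediness implies the embedding -/

lemma classNorm_le_of_le_mul {N : QuasiNorm 𝕜 X} {E F : ℕ → X → ℝ≥0∞} {ω : ℕ → ℝ} {q : ℝ≥0∞}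
    (hq : 0 < q) {C : ℝ≥0∞} (hC : 1 ≤ C) {x : X} (h : ∀ m, 1 ≤ m → E m x ≤ C * F m x) :
    classNorm N E ω q x ≤ C * classNorm N F ω q x := by
  simp only [classNorm]
  rw [mul_add]
  -- The summand `‖x‖` is common to both class norms; `1 ≤ C` is what takes care of it.
  refine add_le_add (le_mul_of_one_le_left zero_le hC) ?_
  have h' : ∀ n, ENNReal.ofReal (ω (n + 1)) * E (n + 1) x ≤
      C * (ENNReal.ofReal (ω (n + 1)) * F (n + 1) x) := fun n => by
    rw [mul_left_comm]; exact mul_le_mul_right (h _ (by omega)) _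
  split_ifs with hqt
  · rw [ENNReal.mul_iSup]
    exact iSup_mono h'
  · have hr : 0 < q.toReal := ENNReal.toReal_pos hq.ne' hqt
    have e : C = (C ^ q.toReal) ^ (1 / q.toReal) := by
      rw [← ENNReal.rpow_mul, mul_one_div_cancel hr.ne', ENNReal.rpow_one]
    conv_rhs => rw [e]
    rw [← ENNReal.mul_rpow_of_nonneg _ _ (by positivity), ← ENNReal.tsum_mul_left]
    refine ENNReal.rpow_le_rpow (ENNReal.tsum_le_tsum fun n => ?_) (by positivity)
    rw [← mul_div_assoc, ← ENNReal.mul_rpow_of_nonneg _ _ hr.le]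
    exact ENNReal.div_le_div_right (ENNReal.rpow_le_rpow (h' n) hr.le) _

lemma IsPartiallyGreedy.contEmbeds (hPG : B.IsPartiallyGreedy) (ω : ℕ → ℝ) {q : ℝ≥0∞}
    (hq : 0 < q) : ContEmbeds (B.partiallyGreedyNorm ω q) (B.greedyNorm ω q) := by
  obtain ⟨C, hC, h⟩ := hPG
  have hle : ∀ x, B.greedyNorm ω q x ≤ ENNReal.ofReal (C + 1) * B.partiallyGreedyNorm ω q x :=
    fun x => classNorm_le_of_le_mul hq (ENNReal.one_le_ofReal.2 (by linarith)) fun m hm =>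
      (h m hm x).trans (mul_le_mul_left (ENNReal.ofReal_le_ofReal (by linarith)) _)
  exact ⟨fun x hx => (hle x).trans_lt (ENNReal.mul_lt_top ENNReal.ofReal_lt_top hx),
    C + 1, by linarith, fun x _ => hle x⟩

end MBasis
end GreedyApprox

theorem theorem1p5 {𝕜 X : Type*} [RCLike 𝕜] [AddCommGroup X] [Module 𝕜 X]
    (N : GreedyApprox.QuasiNorm 𝕜 X) (hN : N.IsComplete)
    (ω : ℕ → ℝ) (hω : GreedyApprox.IsDoublingWeight ω)
    (hi : 0 < GreedyApprox.lowerDilationIndex ω)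
    (B : GreedyApprox.MBasis N) (hB : B.IsQuasiGreedy) :
    (B.IsPartiallyGreedy →
      ∀ q : ℝ≥0∞, 0 < q →
        GreedyApprox.ContEmbeds (B.partiallyGreedyNorm ω q) (B.greedyNorm ω q)) ∧
    (B.IsSchauder → B.PropertyI → B.PropertyWStar →
      (∃ q : ℝ≥0∞, 0 < q ∧
        GreedyApprox.ContEmbeds (B.partiallyGreedyNorm ω q) (B.greedyNorm ω q)) →
      B.IsPartiallyGreedy) := by
  refine ⟨fun hPG q hq => hPG.contEmbeds ω hq, ?_⟩
  rintro hS hI hW ⟨q, hq, hemb⟩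
  exact (GreedyApprox.MBasis.isSuperConservative_of_contEmbeds hω hi hB hS hI hW hq
    hemb).isPartiallyGreedy hB
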